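/- Let $p$ and $q$ be distinct odd primes and put $N=pq$. Let $\mathbb{H}^*=\mathbb{H}\cup\mathbb{P}^1(\mathbb{Q})$ be the extended upper half-plane with its horoball topology, let $X_0(N)=\Gamma_0(N)\backslash\mathbb{H}^*$ carry the quotient topology, and write $\pi:\mathbb{H}^*\to X_0(N)$ for the projection; the points of $\pi(\mathbb{P}^1(\mathbb{Q}))$ are the cusps. The reflection $\sigma(z)=-\bar z$ of $\mathbb{H}$ (with $\sigma(r)=-r$ for $r\in\mathbb{Q}$ and $\sigma(\infty)=\infty$) normalizes the action of $\Gamma_0(N)$ and so induces an involution of $X_0(N)$, again denoted $\sigma$. Let $\mathrm{Fix}(\sigma)\subset X_0(N)$ be its set of fixed points. (i) $\mathrm{Fix}(\sigma)$ contains all cusps and is a disjoint union $\mathcal{C}_1\cup\mathcal{C}_3$ of two simple closed curves (subsets homeomorphic to the circle), each containing exactly two cusps: the cusps on $\mathcal{C}_1$ are the two distinct points $\pi(\infty),\pi(0)$, and those on $\mathcal{C}_3$ are the two distinct points $\pi(1/p),\pi(1/q)$. (ii) There are complete geodesics $G_1,G_1'$ and $G_3,G_3'$ of $\mathbb{H}$,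 with endpoints in $\mathbb{P}^1(\mathbb{Q})=\mathbb{Q}\cup\{\infty\}$, such that the four geodesics are pairwise disjoint in $\mathbb{H}$; for $i=1,3$ the curve $\mathcal{C}_i$ is the image under $\pi$ of $G_i\cup G_i'$ together with their endpoints; $\pi$ is injective on $G_1\cup G_1'\cup G_3\cup G_3'$; and for $i=1,3$ the two endpoints of $G_i$ can be labelled $a_i,b_i$ and those of $G_i'$ labelled $a_i',b_i'$ so that $a_i'\in\Gamma_0(N)a_i$ and $b_i'\in\Gamma_0(N)b_i$. -/

import Mathlib

open scoped UpperHalfPlane MatrixGroups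

noncomputable section

namespace ModCurve

/-- The action of `SL(2, ℤ)` on `P¹(ℚ) = ℚ ∪ {∞}` by fractional linear transformations
(Mathlib's action of `GL(2, ℚ)` on `OnePoint ℚ`). -/
def moveCusp (g : SL(2, ℤ)) (c : OnePoint ℚ) : OnePoint ℚ :=
  Matrix.SpecialLinearGroup.mapGL ℚ g • c

/-- The extended upper half-plane `ℍ* = ℍ ∪ P¹(ℚ)`. -/
inductive ExtHalfPlane : Type
  | point (z : ℍ) : ExtHalfPlane
  | cusp (c : OnePoint ℚ) : ExtHalfPlane

namespace ExtHalfPlane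

instance : MulAction SL(2, ℤ) ExtHalfPlane where
  smul g x := match x with
    | point z => point (g • z)
    | cusp c => cusp (moveCusp g c)
  one_smul x := by
    cases x with
    | point z => exact congrArg point (one_smul _ z)
    | cusp c =>
      refine congrArg cusp ?_
      simp [moveCusp]
  mul_smul g h x := by
    cases x with
    | point z => exact congrArg point (mul_smul g h z)
    | cusp c =>
      refine congrArg cusp ?_
      simp [moveCusp, mul_smul]

/-- The points of `ℍ` in the open horoball at the cusp `c` with parameter `T > 0`: the half-plane
`Im z > T` at `∞`, and the open Euclidean disc of radius `1 / (2 T)` tangent to the real axis at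
`r`, that is `Im z / |z - r|² > T`, at `r ∈ ℚ`. -/
def horoball (c : OnePoint ℚ) (T : ℝ) : Set ℍ :=
  c.elim {z | T < z.im} (fun r => {z | T < z.im / Complex.normSq ((z : ℂ) - (r : ℂ))})

lemma horoball_anti (c : OnePoint ℚ) {S T : ℝ} (h : S ≤ T) : horoball c T ⊆ horoball c S := by
  intro z hz
  cases c with
  | infty => exact lt_of_le_of_lt h hz
  | coe r => exact lt_of_le_of_lt h hz

/-- The horoball topology of `ℍ*`: it induces the usual topology on the open subset `ℍ`, and the
sets `{c} ∪ horoball c T` with `T > 0` are a basis of neighbourhoods of the cusp `c`. -/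
instance : TopologicalSpace ExtHalfPlane where
  IsOpen U := IsOpen {z : ℍ | point z ∈ U} ∧
    ∀ c : OnePoint ℚ, cusp c ∈ U → ∃ T : ℝ, 0 < T ∧ ∀ z ∈ horoball c T, point z ∈ U
  isOpen_univ := ⟨by simp, fun _ _ => ⟨1, one_pos, fun _ _ => trivial⟩⟩
  isOpen_inter U V hU hV := by
    refine ⟨hU.1.inter hV.1, fun c hc => ?_⟩
    obtain ⟨S, hS, hSU⟩ := hU.2 c hc.1
    obtain ⟨T, hT, hTV⟩ := hV.2 c hc.2
    exact ⟨max S T, lt_max_of_lt_left hS, fun z hz =>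
      ⟨hSU z (horoball_anti c (le_max_left S T) hz),
        hTV z (horoball_anti c (le_max_right S T) hz)⟩⟩
  isOpen_sUnion F hF := by
    refine ⟨?_, ?_⟩
    · have h : {z : ℍ | point z ∈ ⋃₀ F} = ⋃ U ∈ F, {z : ℍ | point z ∈ U} := by
        ext z
        simp
      rw [h]
      exact isOpen_biUnion fun U hU => (hF U hU).1
    · rintro c ⟨U, hU, hc⟩
      obtain ⟨T, hT, hTU⟩ := (hF U hU).2 c hc
      exact ⟨T, hT, fun z hz => ⟨U, hU, hTU z hz⟩⟩

/-- The reflection `σ(z) = - conj z` of `ℍ`, with `σ(r) = -r` and `σ(∞) = ∞` on `P¹(ℚ)`. -/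
def refl : ExtHalfPlane → ExtHalfPlane
  | point z => point ⟨-(starRingEnd ℂ) (z : ℂ), by simpa using z.im_pos⟩
  | cusp c => cusp (c.map (fun r => -r))

end ExtHalfPlane

open ExtHalfPlane

/-- The conjugate of `(a, b; c, d)` by the reflection `σ`, namely `(a, -b; -c, d)`. -/
def hat (g : SL(2, ℤ)) : SL(2, ℤ) :=
  ⟨!![g 0 0, -(g 0 1); -(g 1 0), g 1 1], by
    have h := g.det_coe
    rw [Matrix.det_fin_two] at h
    rw [Matrix.det_fin_two_of]
    linarith⟩

lemma refl_smul (g : SL(2, ℤ)) (x : ExtHalfPlane) : refl (g • x) = hat g • refl x := by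
  have h00 : (hat g) 0 0 = g 0 0 := rfl
  have h01 : (hat g) 0 1 = -(g 0 1) := rfl
  have h10 : (hat g) 1 0 = -(g 1 0) := rfl
  have h11 : (hat g) 1 1 = g 1 1 := rfl
  cases x with
  | point z =>
    refine congrArg point (UpperHalfPlane.ext ?_)
    change -(starRingEnd ℂ) ((g • z : ℍ) : ℂ) = _
    rw [UpperHalfPlane.coe_specialLinearGroup_apply, UpperHalfPlane.coe_specialLinearGroup_apply]
    simp [h00, h01, h10, h11, neg_div', neg_add_rev, add_comm]
  | cusp c =>
    refine congrArg cusp ?_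
    unfold moveCusp
    cases c with
    | infty =>
      rw [OnePoint.map_infty, OnePoint.smul_infty_eq_ite, OnePoint.smul_infty_eq_ite]
      by_cases h : g 1 0 = 0
      · simp [h10, h]
      · simp [h00, h10, h, div_neg]
    | coe r =>
      rw [OnePoint.map_some, OnePoint.smul_some_eq_ite, OnePoint.smul_some_eq_ite]
      by_cases h : (g 1 0 : ℚ) * r + g 1 1 = 0
      · simp [h10, h11, h]
      · simp [h00, h01, h10, h11, h]
        rw [← neg_div]
        congr 2
        ring

lemma hat_mem {N : ℕ} {g : SL(2, ℤ)} (hg : g ∈ CongruenceSubgroup.Gamma0 N) :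
    hat g ∈ CongruenceSubgroup.Gamma0 N := by
  rw [CongruenceSubgroup.Gamma0_mem] at hg ⊢
  simp [hat, hg]

/-- The modular curve `X₀(N) = Γ₀(N) \ ℍ*`, as a set of orbits. -/
def X0 (N : ℕ) : Type :=
  MulAction.orbitRel.Quotient (CongruenceSubgroup.Gamma0 N) ExtHalfPlane

/-- The projection `ℍ* → X₀(N)`. -/
def proj (N : ℕ) (x : ExtHalfPlane) : X0 N :=
  Quotient.mk (MulAction.orbitRel (CongruenceSubgroup.Gamma0 N) ExtHalfPlane) x

/-- `X₀(N)` carries the quotient topology. -/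
instance (N : ℕ) : TopologicalSpace (X0 N) := TopologicalSpace.coinduced (proj N) inferInstance

/-- The involution of `X₀(N)` induced by `σ`. -/
def sigma (N : ℕ) : X0 N → X0 N :=
  Quotient.map refl (by
    rintro x y ⟨g, hg⟩
    refine ⟨⟨hat (g : SL(2, ℤ)), hat_mem g.2⟩, ?_⟩
    have h : (g : SL(2, ℤ)) • y = x := hg
    exact (h ▸ refl_smul (g : SL(2, ℤ)) y).symm)

lemma sigma_proj (N : ℕ) (x : ExtHalfPlane) : sigma N (proj N x) = proj N (refl x) := rfl

/-- The set of points of `X₀(N)` fixed by `σ`. -/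
def fixSet (N : ℕ) : Set (X0 N) := {x | sigma N x = x}

/-- The set of cusps of `X₀(N)`. -/
def cusps (N : ℕ) : Set (X0 N) := Set.range fun c : OnePoint ℚ => proj N (cusp c)

/-- A simple closed curve in a topological space: a subset homeomorphic to the circle. -/
def IsSimpleClosedCurve {X : Type*} [TopologicalSpace X] (C : Set X) : Prop :=
  ∃ f : Circle → X, Topology.IsEmbedding f ∧ Set.range f = C

/-- The complete hyperbolic geodesic of `ℍ` with distinct endpoints `a, b ∈ P¹(ℚ)`: a vertical line
if one endpoint is `∞`, and the half-circle with diameter `[a, b]` otherwise. (It is empty for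
`a = b`.) -/
def geodesic (a b : OnePoint ℚ) : Set ℍ :=
  a.elim (b.elim ∅ fun s => {z | z.re = s})
    fun r => b.elim {z | z.re = r}
      fun s => {z | ‖(z : ℂ) - ((r : ℂ) + s) / 2‖ = |(r : ℝ) - s| / 2}

/-- The geodesic together with its two endpoints, as a subset of `ℍ*`. -/
def closedGeodesic (a b : OnePoint ℚ) : Set ExtHalfPlane :=
  point '' geodesic a b ∪ {cusp a, cusp b}

end ModCurve

end

/-
A point of `X₀(N)` is fixed by `σ` exactly when it is a cusp or the image of a point of `ℍ` on the
mirror of a reflection `hσ` with `h ∈ Γ₀(N)`. Up to conjugation by `Γ₀(N)` and sign, such a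
reflection is determined by its diagonal entry, a square root of `1` modulo `N`, and by whether `h`
is trivial modulo `2`; for `N = pq` this leaves four classes, one for each of the four explicit
geodesics. No nontrivial element of `Γ₀(N)` can carry a point of one of these mirrors to a point of
another, so the geodesics embed in `X₀(N)`. Their ends converge to cusps, whose classes are
separated by `gcd (N, denominator)`. Hence the geodesics close up in pairs to two loops, which are
circles because `X₀(N)` is Hausdorff.
-/

namespace ModCurve

open ExtHalfPlane CongruenceSubgroup OnePoint
open scoped Matrix

section Cusps

/-- The cusp with homogeneous coordinates `v ≠ 0`; a vanishing denominator means `∞`. -/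
def cuspOf (v : Fin 2 → ℤ) : OnePoint ℚ :=
  if v 1 = 0 then ∞ else ((v 0 / v 1 : ℚ) : OnePoint ℚ)

lemma exists_cuspOf (c : OnePoint ℚ) : ∃ v : Fin 2 → ℤ, IsCoprime (v 0) (v 1) ∧ cuspOf v = c := by
  cases c with
  | infty => exact ⟨![1, 0], isCoprime_one_left, by simp [cuspOf]⟩
  | coe r =>
    refine ⟨![r.num, r.den], ?_, by simp [cuspOf, r.den_ne_zero, Rat.num_div_den]⟩
    exact Int.isCoprime_iff_gcd_eq_one.2 (by simpa [Int.gcd] using r.reduced)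

lemma ne_zero_of_isCoprime {v : Fin 2 → ℤ} (hv : IsCoprime (v 0) (v 1)) : v ≠ 0 := by
  rintro rfl
  exact not_isCoprime_zero_zero hv

lemma intCast_comp_ne_zero {v : Fin 2 → ℤ} (hv : v ≠ 0) : (fun i => (v i : ℚ)) ≠ 0 := fun h =>
  hv (funext fun i => Int.cast_injective (α := ℚ) (by simpa using congrFun h i))

lemma equivProjectivization_cuspOf {v : Fin 2 → ℤ} (hv : v ≠ 0) :
    equivProjectivization ℚ (cuspOf v) =
      Projectivization.mk ℚ (fun i => (v i : ℚ)) (intCast_comp_ne_zero hv) := by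
  rw [← Equiv.eq_symm_apply, equivProjectivization_symm_apply_mk]
  simp [cuspOf, div_eq_inv_mul]

lemma moveCusp_cuspOf (g : SL(2, ℤ)) {v : Fin 2 → ℤ} (hv : v ≠ 0) :
    moveCusp g (cuspOf v) = cuspOf (g • v) := by
  have hgv : g • v ≠ 0 := (smul_ne_zero_iff_ne g).2 hv
  apply (equivProjectivization ℚ).injective
  rw [moveCusp, equivProjectivization_smul, equivProjectivization_cuspOf hv,
    equivProjectivization_cuspOf hgv, Projectivization.smul_mk]
  congr 1
  ext i
  fin_cases i <;> simp [Matrix.SpecialLinearGroup.smul_def, Units.smul_def, Matrix.mulVec_eq_sum,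
    mul_comm]

lemma cuspOf_eq_cuspOf_iff {v w : Fin 2 → ℤ} (hv : v ≠ 0) (hw : w ≠ 0) :
    cuspOf v = cuspOf w ↔ v 0 * w 1 = w 0 * v 1 := by
  have hv' : v 1 = 0 → v 0 ≠ 0 := fun h1 h0 => hv (by ext i; fin_cases i <;> assumption)
  have hw' : w 1 = 0 → w 0 ≠ 0 := fun h1 h0 => hw (by ext i; fin_cases i <;> assumption)
  by_cases h1 : v 1 = 0 <;> by_cases h2 : w 1 = 0
  · simp [cuspOf, h1, h2]
  · simp [cuspOf, h1, h2, hv' h1]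
  · simp [cuspOf, h1, h2, hw' h2]
  · have h1' : (v 1 : ℚ) ≠ 0 := by exact_mod_cast h1
    have h2' : (w 1 : ℚ) ≠ 0 := by exact_mod_cast h2
    rw [cuspOf, cuspOf, if_neg h1, if_neg h2, OnePoint.coe_eq_coe, div_eq_div_iff h1' h2']
    norm_cast

lemma natAbs_eq_of_cuspOf_eq {v w : Fin 2 → ℤ} (hv : IsCoprime (v 0) (v 1))
    (hw : IsCoprime (w 0) (w 1)) (h : cuspOf v = cuspOf w) : (v 1).natAbs = (w 1).natAbs := by
  rw [cuspOf_eq_cuspOf_iff (ne_zero_of_isCoprime hv) (ne_zero_of_isCoprime hw)] at h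
  exact Int.natAbs_eq_of_dvd_dvd (hv.symm.dvd_of_dvd_mul_left (h ▸ Dvd.intro_left _ rfl))
    (hw.symm.dvd_of_dvd_mul_left (h ▸ Dvd.intro_left _ rfl))

lemma refl_cuspOf (v : Fin 2 → ℤ) : refl (cusp (cuspOf v)) = cusp (cuspOf ![-v 0, v 1]) := by
  by_cases h : v 1 = 0 <;> simp [cuspOf, h, ExtHalfPlane.refl, neg_div]

end Cusps

section Orbits

variable {N : ℕ}

lemma proj_eq_iff {x y : ExtHalfPlane} : proj N x = proj N y ↔ ∃ g ∈ Gamma0 N, g • y = x := by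
  refine (Quotient.eq (r := MulAction.orbitRel (Gamma0 N) ExtHalfPlane)).trans ?_
  simp [MulAction.orbitRel_apply, MulAction.mem_orbit_iff, Subgroup.smul_def]

lemma smul_cusp (g : SL(2, ℤ)) (c : OnePoint ℚ) : g • cusp c = cusp (moveCusp g c) := rfl

lemma smul_point (g : SL(2, ℤ)) (z : ℍ) : g • point z = point (g • z) := rfl

lemma proj_point_eq_iff {z w : ℍ} :
    proj N (point z) = proj N (point w) ↔ ∃ g ∈ Gamma0 N, g • w = z := by
  simp [proj_eq_iff, smul_point]

lemma proj_cusp_eq_iff {a b : OnePoint ℚ} :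
    proj N (cusp a) = proj N (cusp b) ↔ ∃ g ∈ Gamma0 N, moveCusp g b = a := by
  simp [proj_eq_iff, smul_cusp]

lemma proj_cusp_ne_point (c : OnePoint ℚ) (z : ℍ) : proj N (cusp c) ≠ proj N (point z) := by
  simp [Ne, proj_eq_iff, smul_point]

lemma mem_Gamma0_iff_dvd {g : SL(2, ℤ)} : g ∈ Gamma0 N ↔ (N : ℤ) ∣ g 1 0 := by
  rw [Gamma0_mem, ZMod.intCast_zmod_eq_zero_iff_dvd]

lemma det_eq_one (g : SL(2, ℤ)) : g 0 0 * g 1 1 - g 0 1 * g 1 0 = 1 := by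
  rw [← Matrix.det_fin_two, g.det_coe]

end Orbits

section CuspClasses

variable {N : ℕ} {v w : Fin 2 → ℤ}

lemma smul_vec_zero (g : SL(2, ℤ)) (v : Fin 2 → ℤ) : (g • v) 0 = g 0 0 * v 0 + g 0 1 * v 1 := by
  simp [Matrix.SpecialLinearGroup.smul_def, Matrix.mulVec_eq_sum, mul_comm]

lemma smul_vec_one (g : SL(2, ℤ)) (v : Fin 2 → ℤ) : (g • v) 1 = g 1 0 * v 0 + g 1 1 * v 1 := by
  simp [Matrix.SpecialLinearGroup.smul_def, Matrix.mulVec_eq_sum, mul_comm]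

lemma gcd_smul_of_mem_Gamma0 {g : SL(2, ℤ)} (hg : g ∈ Gamma0 N) (v : Fin 2 → ℤ) :
    Int.gcd N ((g • v) 1) = Int.gcd N (v 1) := by
  obtain ⟨k, hk⟩ := mem_Gamma0_iff_dvd.1 hg
  have hcop : IsCoprime (N : ℤ) (g 1 1) :=
    ⟨-(g 0 1 * k), g 0 0, by linear_combination det_eq_one g + g 0 1 * hk⟩
  rw [smul_vec_one, hk, mul_assoc, add_comm, Int.gcd_add_mul_left_right]
  exact Int.gcd_mul_right_right_of_gcd_eq_one (Int.isCoprime_iff_gcd_eq_one.1 hcop)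

lemma gcd_eq_of_proj_eq (hv : IsCoprime (v 0) (v 1)) (hw : IsCoprime (w 0) (w 1))
    (h : proj N (cusp (cuspOf v)) = proj N (cusp (cuspOf w))) :
    Int.gcd N (v 1) = Int.gcd N (w 1) := by
  obtain ⟨g, hg, hgw⟩ := proj_cusp_eq_iff.1 h
  rw [moveCusp_cuspOf g (ne_zero_of_isCoprime hw)] at hgw
  rw [← gcd_smul_of_mem_Gamma0 hg w]
  exact congrArg (Nat.gcd _) (natAbs_eq_of_cuspOf_eq (hw.mulVecSL g) hv hgw).symm

lemma gcd_mul_dvd_of_squarefree (hN : Squarefree N) {y y' : ℤ}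
    (h : Int.gcd N y = Int.gcd N y') : Int.gcd N (y * y') ∣ Int.gcd N y := by
  have hsq : Squarefree (Int.gcd N (y * y')) :=
    hN.squarefree_of_dvd (by simpa using Int.gcd_dvd_natAbs_left (N : ℤ) (y * y'))
  refine (hsq.dvd_pow_iff_dvd two_ne_zero).1 ?_
  calc Int.gcd N (y * y') ∣ Int.gcd N y * Int.gcd N y' := Int.gcd_mul_right_dvd_mul_gcd _ _ _
    _ = Int.gcd N y ^ 2 := by rw [← h, sq]

/-- With `g e₁ = v` and `k e₁ = w`, every `k Tᵐ g⁻¹` maps `v` to `w`; membership in `Γ₀(N)` is a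
linear congruence for `m`, solvable because `N` is squarefree. -/
lemma exists_smul_eq_of_gcd_eq (hN : Squarefree N) (hv : IsCoprime (v 0) (v 1))
    (hw : IsCoprime (w 0) (w 1)) (h : Int.gcd N (v 1) = Int.gcd N (w 1)) :
    ∃ g ∈ Gamma0 N, g • v = w := by
  obtain ⟨g, hg0, hg1⟩ := hv.exists_SL2_col 0
  obtain ⟨k, hk0, hk1⟩ := hw.exists_SL2_col 0
  have hdvd : (Int.gcd N (v 1 * w 1) : ℤ) ∣ w 1 * g 1 1 - v 1 * k 1 1 := by
    refine dvd_trans (Int.natCast_dvd_natCast.2 (gcd_mul_dvd_of_squarefree hN h)) (dvd_sub ?_ ?_)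
    · exact (h ▸ Int.gcd_dvd_right (N : ℤ) (w 1)).mul_right _
    · exact (Int.gcd_dvd_right (N : ℤ) (v 1)).mul_right _
  obtain ⟨l, m, hlm⟩ : ∃ l m : ℤ, w 1 * g 1 1 - v 1 * k 1 1 = N * l + v 1 * w 1 * m := by
    obtain ⟨c, hc⟩ := hdvd
    rw [Int.gcd_eq_gcd_ab, add_mul, mul_assoc, mul_assoc _ _ c] at hc
    exact ⟨_, _, hc⟩
  have hT := ModularGroup.coe_T_zpow m
  have he : ∀ a : SL(2, ℤ), a • ![1, 0] = ![a 0 0, a 1 0] := fun a => by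
    ext i; fin_cases i <;> simp [smul_vec_zero, smul_vec_one]
  have hgv : g • ![1, 0] = v := by ext i; fin_cases i <;> simp [he, hg0, hg1]
  have hkw : k • ![1, 0] = w := by ext i; fin_cases i <;> simp [he, hk0, hk1]
  have hTe : ModularGroup.T ^ m • ![1, 0] = (![1, 0] : Fin 2 → ℤ) := by rw [he, hT]; simp
  refine ⟨k * ModularGroup.T ^ m * g⁻¹, mem_Gamma0_iff_dvd.2 ⟨l, ?_⟩, ?_⟩
  · simp only [Matrix.SpecialLinearGroup.coe_mul, Matrix.SpecialLinearGroup.coe_inv,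
      Matrix.adjugate_fin_two, Matrix.mul_apply, Fin.sum_univ_two, hT, Matrix.of_apply,
      Matrix.cons_val', Matrix.cons_val_zero, Matrix.cons_val_one, Matrix.cons_val_fin_one, hg1,
      hk1]
    linear_combination hlm
  · rw [← hgv, mul_smul, mul_smul, inv_smul_smul, hTe, hkw]

theorem proj_cuspOf_eq_iff (hN : Squarefree N) (hv : IsCoprime (v 0) (v 1))
    (hw : IsCoprime (w 0) (w 1)) :
    proj N (cusp (cuspOf v)) = proj N (cusp (cuspOf w)) ↔ Int.gcd N (v 1) = Int.gcd N (w 1) := by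
  refine ⟨gcd_eq_of_proj_eq hv hw, fun h => ?_⟩
  obtain ⟨g, hg, rfl⟩ := exists_smul_eq_of_gcd_eq hN hw hv h.symm
  exact proj_cusp_eq_iff.2 ⟨g, hg, moveCusp_cuspOf g (ne_zero_of_isCoprime hw)⟩

lemma proj_one_div_eq (hN : Squarefree N) (hv : IsCoprime (v 0) (v 1)) {r : ℕ} (hr : r ≠ 0)
    (hvr : v 1 = r) :
    proj N (cusp ((1 / (r : ℚ) : ℚ) : OnePoint ℚ)) = proj N (cusp (cuspOf v)) := by
  have hcusp : ((1 / (r : ℚ) : ℚ) : OnePoint ℚ) = cuspOf ![1, (r : ℤ)] := by simp [cuspOf, hr]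
  rw [hcusp, proj_cuspOf_eq_iff hN isCoprime_one_left hv, hvr]
  rfl

theorem cusps_subset_fixSet (hN : Squarefree N) : cusps N ⊆ fixSet N := by
  rintro _ ⟨c, rfl⟩
  obtain ⟨v, hv, rfl⟩ := exists_cuspOf c
  change sigma N (proj N (cusp (cuspOf v))) = proj N (cusp (cuspOf v))
  rw [sigma_proj, refl_cuspOf]
  exact (proj_cuspOf_eq_iff hN hv.neg_left hv).2 rfl

end CuspClasses

section Heights

open Complex

/-- The linear form `v 1 * z - v 0`, which vanishes at the cusp `cuspOf v`. -/
def linForm (v : Fin 2 → ℤ) (z : ℍ) : ℂ := v 1 * z - v 0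

/-- The height of `z` over the cusp `cuspOf v`. For primitive `v` the horoballs at that cusp are,
up to the normalization of the parameter, the sets of points of height larger than a constant. -/
noncomputable def height (v : Fin 2 → ℤ) (z : ℍ) : ℝ := z.im / normSq (linForm v z)

/-- An integer matrix of positive determinant as a real Möbius transformation. -/
noncomputable def toGL {M : Matrix (Fin 2) (Fin 2) ℤ} (hM : 0 < M.det) : GL (Fin 2) ℝ :=
  .mkOfDetNeZero (M.map (Int.castRingHom ℝ)) (by
    rw [← RingHom.mapMatrix_apply, ← RingHom.map_det]
    exact Int.cast_ne_zero.2 hM.ne')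

variable {M : Matrix (Fin 2) (Fin 2) ℤ} (hM : 0 < M.det) {v w : Fin 2 → ℤ}

lemma toGL_apply (i j : Fin 2) : toGL hM i j = M i j := rfl

lemma det_toGL : (toGL hM).det.val = M.det := by
  simp [Matrix.det_fin_two, toGL_apply]

lemma toGL_coe (g : SL(2, ℤ)) (h : 0 < g.1.det) :
    toGL h = Matrix.SpecialLinearGroup.mapGL ℝ g := by
  ext i j
  simp [toGL_apply]

lemma linForm_smul (v : Fin 2 → ℤ) (z : ℍ) :
    linForm (M *ᵥ v) (toGL hM • z) * UpperHalfPlane.denom (toGL hM) z = M.det * linForm v z := by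
  have hd := UpperHalfPlane.denom_ne_zero (toGL hM) z
  rw [linForm, UpperHalfPlane.coe_smul_of_det_pos (by
      rw [det_toGL]; exact_mod_cast hM), sub_mul,
    mul_assoc, div_mul_cancel₀ _ hd]
  simp only [UpperHalfPlane.num, UpperHalfPlane.denom, toGL_apply, linForm, Matrix.det_fin_two,
    Matrix.mulVec_eq_sum, Fin.sum_univ_two]
  simp
  ring

lemma linForm_ne_zero (hv : v ≠ 0) (z : ℍ) : linForm v z ≠ 0 := by
  have h : ![(v 1 : ℝ), -v 0] ≠ 0 := fun h => hv <| by
    ext i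
    fin_cases i
    · simpa using congrFun h 1
    · simpa using congrFun h 0
  simpa [linForm, sub_eq_add_neg] using UpperHalfPlane.linear_ne_zero z h

lemma height_smul (v : Fin 2 → ℤ) (z : ℍ) :
    height (M *ᵥ v) (toGL hM • z) = height v z / M.det := by
  have hM' : (0 : ℝ) < M.det := by exact_mod_cast hM
  have h := congrArg normSq (linForm_smul hM v z)
  rw [map_mul, map_mul, normSq_intCast] at h
  rw [height, height, UpperHalfPlane.im_smul_eq_div_normSq, det_toGL, abs_of_pos hM', div_div,
    mul_comm (normSq (UpperHalfPlane.denom _ _)), h, div_div, mul_assoc,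
    mul_div_mul_left _ _ hM'.ne', mul_comm]

lemma height_SL_smul (g : SL(2, ℤ)) (v : Fin 2 → ℤ) (z : ℍ) :
    height (g • v) (g • z) = height v z := by
  have h := height_smul (M := g) (by simp) v z
  rwa [toGL_coe, g.det_coe, Int.cast_one, div_one] at h

lemma normSq_linForm (v : Fin 2 → ℤ) (z : ℍ) :
    normSq (linForm v z) = (v 1 * z.re - v 0) ^ 2 + (v 1 * z.im) ^ 2 := by
  simp [linForm, normSq_apply, ← sq]

lemma continuous_height (hv : v ≠ 0) : Continuous (height v) := by
  refine UpperHalfPlane.continuous_im.div (Complex.continuous_normSq.comp ?_)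
    fun z => (normSq_pos.2 (linForm_ne_zero hv z)).ne'
  exact (continuous_const.mul UpperHalfPlane.continuous_coe).sub continuous_const

lemma one_le_intCast_sq {n : ℤ} (hn : n ≠ 0) : (1 : ℝ) ≤ (n : ℝ) ^ 2 := by
  rw [one_le_sq_iff_one_le_abs]
  exact_mod_cast Int.one_le_abs hn

lemma height_le (hv : v ≠ 0) (z : ℍ) : height v z ≤ max z.im z.im⁻¹ := by
  have hz := z.im_pos
  rw [height, normSq_linForm]
  by_cases h1 : v 1 = 0
  · have h0 : v 0 ≠ 0 := fun h0 => hv (by ext i; fin_cases i <;> assumption)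
    refine (div_le_self hz.le ?_).trans (le_max_left _ _)
    simpa [h1] using one_le_intCast_sq h0
  · refine le_trans ?_ (le_max_right _ _)
    rw [← div_self_mul_self', ← sq]
    gcongr
    calc z.im ^ 2 ≤ (v 1) ^ 2 * z.im ^ 2 :=
          le_mul_of_one_le_left (sq_nonneg _) (one_le_intCast_sq h1)
      _ ≤ _ := by rw [mul_pow]; exact le_add_of_nonneg_left (sq_nonneg _)

lemma im_linForm_mul_conj (v w : Fin 2 → ℤ) (z : ℍ) :
    (linForm v z * (starRingEnd ℂ) (linForm w z)).im = (v 0 * w 1 - w 0 * v 1 : ℤ) * z.im := by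
  simp [linForm]
  ring

lemma sq_mul_height_mul_height_le (hv : v ≠ 0) (hw : w ≠ 0) (z : ℍ) :
    ((v 0 * w 1 - w 0 * v 1 : ℤ) : ℝ) ^ 2 * (height v z * height w z) ≤ 1 := by
  have hv' := normSq_pos.2 (linForm_ne_zero hv z)
  have hw' := normSq_pos.2 (linForm_ne_zero hw z)
  rw [height, height, div_mul_div_comm, ← mul_div_assoc, div_le_one (by positivity)]
  calc ((v 0 * w 1 - w 0 * v 1 : ℤ) : ℝ) ^ 2 * (z.im * z.im)
      = (linForm v z * (starRingEnd ℂ) (linForm w z)).im ^ 2 := by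
        rw [im_linForm_mul_conj]; ring
    _ ≤ normSq (linForm v z * (starRingEnd ℂ) (linForm w z)) := by
        rw [sq]; exact im_sq_le_normSq _
    _ = _ := by rw [map_mul, normSq_conj]

lemma cuspOf_eq_of_one_lt_height (hv : v ≠ 0) (hw : w ≠ 0) {z : ℍ} (h : 1 < height v z)
    (h' : 1 < height w z) : cuspOf v = cuspOf w := by
  rw [cuspOf_eq_cuspOf_iff hv hw, ← sub_eq_zero]
  by_contra hne
  have hsq := one_le_intCast_sq hne
  have hh : 1 < height v z * height w z := one_lt_mul_of_lt_of_le h h'.le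
  nlinarith [sq_mul_height_mul_height_le hv hw z]

lemma exists_horoball_iff_lt_height (hv : v ≠ 0) :
    ∃ K > 0, ∀ T z, z ∈ horoball (cuspOf v) T ↔ T < K * height v z := by
  by_cases h1 : v 1 = 0
  · have h0 : (v 0 : ℝ) ≠ 0 := fun h0 => hv (by ext i; fin_cases i; exacts [mod_cast h0, h1])
    refine ⟨(v 0) ^ 2, by positivity, fun T z => ?_⟩
    have hz : (v 0 : ℝ) ^ 2 * height v z = z.im := by
      rw [height, normSq_linForm]
      simp [h1, field]
    simp [hz, cuspOf, h1, horoball]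
  · have h1' : (v 1 : ℝ) ≠ 0 := by exact_mod_cast h1
    refine ⟨(v 1) ^ 2, by positivity, fun T z => ?_⟩
    have hz : (z : ℂ) - ((v 0 / v 1 : ℚ) : ℂ) = linForm v z / v 1 := by
      have : (v 1 : ℂ) ≠ 0 := by exact_mod_cast h1
      rw [linForm]
      push_cast
      field_simp
    have hn : (v 1 : ℝ) ^ 2 * height v z = z.im / normSq ((z : ℂ) - ((v 0 / v 1 : ℚ) : ℂ)) := by
      rw [hz, map_div₀, normSq_intCast, height]
      field_simp
    rw [hn]
    simp [cuspOf, h1, horoball]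

end Heights

section Topology

open Complex Filter Topology

lemma isOpen_iff_height {U : Set ExtHalfPlane} : IsOpen U ↔ IsOpen (point ⁻¹' U) ∧
    ∀ v ≠ 0, cusp (cuspOf v) ∈ U → ∃ T, ∀ z, T < height v z → point z ∈ U := by
  refine and_congr_right fun _ => ⟨fun h v hv hc => ?_, fun h c hc => ?_⟩
  · obtain ⟨T, -, hU⟩ := h _ hc
    obtain ⟨K, hK, hKT⟩ := exists_horoball_iff_lt_height hv
    refine ⟨T / K, fun z hz => hU z ((hKT T z).2 ?_)⟩
    rwa [div_lt_iff₀' hK] at hz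
  · obtain ⟨v, hv, rfl⟩ := exists_cuspOf c
    obtain ⟨T, hU⟩ := h v (ne_zero_of_isCoprime hv) hc
    obtain ⟨K, hK, hKT⟩ := exists_horoball_iff_lt_height (ne_zero_of_isCoprime hv)
    refine ⟨K * max T 1, by positivity, fun z hz => hU z ?_⟩
    exact (le_max_left _ _).trans_lt (lt_of_mul_lt_mul_left ((hKT _ z).1 hz) hK.le)

lemma isOpenEmbedding_point : IsOpenEmbedding point := by
  refine .of_continuous_injective_isOpenMap ⟨fun U hU => hU.1⟩ (fun _ _ h => point.inj h) ?_
  refine fun U hU => isOpen_iff_height.2 ⟨?_, fun v _ hc => ?_⟩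
  · rwa [Set.preimage_image_eq _ fun _ _ h => point.inj h]
  · simp at hc

instance : ContinuousConstSMul SL(2, ℤ) ℍ where
  continuous_const_smul g :=
    (isometry_smul ℍ (Matrix.SpecialLinearGroup.map (algebraMap ℤ ℝ) g : SL(2, ℝ))).continuous

instance : ContinuousConstSMul SL(2, ℤ) ExtHalfPlane := by
  refine ⟨fun g => ⟨fun U hU => ?_⟩⟩
  rw [isOpen_iff_height] at hU ⊢
  refine ⟨hU.1.preimage (continuous_const_smul g), fun v hv hc => ?_⟩
  rw [Set.mem_preimage, smul_cusp, moveCusp_cuspOf g hv] at hc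
  obtain ⟨T, h⟩ := hU.2 _ ((smul_ne_zero_iff_ne g).2 hv) hc
  exact ⟨T, fun z hz => h (g • z) (by rwa [height_SL_smul])⟩

instance {G X : Type*} [Group G] [TopologicalSpace X] [MulAction G X] [ContinuousConstSMul G X]
    (Γ : Subgroup G) : ContinuousConstSMul Γ X :=
  ⟨fun g => continuous_const_smul (g : G)⟩

/-- The cusp `cuspOf v` together with the points of height larger than `T` over it. -/
def cuspNhd (v : Fin 2 → ℤ) (T : ℝ) : Set ExtHalfPlane :=
  insert (cusp (cuspOf v)) (point '' {z | T < height v z})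

variable {v : Fin 2 → ℤ}

lemma cuspNhd_mem_nhds (hv : v ≠ 0) (T : ℝ) : cuspNhd v T ∈ 𝓝 (cusp (cuspOf v)) := by
  refine IsOpen.mem_nhds ⟨?_, fun c hc => ?_⟩ (Set.mem_insert _ _)
  · simpa [cuspNhd] using isOpen_lt continuous_const (continuous_height hv)
  · obtain rfl : c = cuspOf v := by simpa [cuspNhd] using hc
    obtain ⟨K, hK, hKT⟩ := exists_horoball_iff_lt_height hv
    refine ⟨K * max T 1, by positivity, fun z hz => Or.inr ⟨z, ?_, rfl⟩⟩
    exact (le_max_left _ _).trans_lt (lt_of_mul_lt_mul_left ((hKT _ z).1 hz) hK.le)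

lemma tendsto_point_nhds_cusp {α : Type*} {l : Filter α} {φ : α → ℍ} (hv : v ≠ 0)
    (h : Tendsto (fun t => height v (φ t)) l atTop) :
    Tendsto (fun t => point (φ t)) l (𝓝 (cusp (cuspOf v))) := by
  refine tendsto_nhds.2 fun U hU hc => ?_
  obtain ⟨T, hT⟩ := (isOpen_iff_height.1 hU).2 v hv hc
  exact (h.eventually_gt_atTop T).mono fun t => hT (φ t)

end Topology

section Separation

open Complex Filter Topology

variable {N : ℕ}

lemma continuous_proj (N : ℕ) : Continuous (proj N) := continuous_coinduced_rng

lemma isOpenMap_proj (N : ℕ) : IsOpenMap (proj N) :=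
  isOpenMap_quotient_mk'_mul (Γ := Gamma0 N) (T := ExtHalfPlane)

lemma disjoint_nhds_proj {x y : ExtHalfPlane} {U V : Set ExtHalfPlane} (hU : U ∈ 𝓝 x)
    (hV : V ∈ 𝓝 y) (h : ∀ a ∈ U, ∀ b ∈ V, proj N a ≠ proj N b) :
    Disjoint (𝓝 (proj N x)) (𝓝 (proj N y)) := by
  refine disjoint_of_disjoint_of_mem ?_ ((isOpenMap_proj N).image_mem_nhds hU)
    ((isOpenMap_proj N).image_mem_nhds hV)
  rw [Set.disjoint_left]
  rintro _ ⟨a, ha, rfl⟩ ⟨b, hb, hab⟩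
  exact h a ha b hb hab.symm

instance (Γ : Subgroup SL(2, ℤ)) : ProperlyDiscontinuousSMul Γ ℍ where
  finite_disjoint_inter_image {K L} hK hL := by
    have hfin := ProperlyDiscontinuousSMul.finite_disjoint_inter_image
      (Γ := (Matrix.SpecialLinearGroup.mapGL ℝ : SL(2, ℤ) →* GL (Fin 2) ℝ).range) hK hL
    refine hfin.of_injOn (f := fun γ : Γ => ⟨Matrix.SpecialLinearGroup.mapGL ℝ γ.1, γ.1, rfl⟩)
      (fun γ hγ => hγ) fun γ _ γ' _ h => Subtype.ext ?_
    exact Matrix.SpecialLinearGroup.mapGL_injective (congrArg Subtype.val h)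

lemma disjoint_nhds_proj_point {z w : ℍ} (h : proj N (point z) ≠ proj N (point w)) :
    Disjoint (𝓝 (proj N (point z))) (𝓝 (proj N (point w))) := by
  let mk : ℍ → MulAction.orbitRel.Quotient (Gamma0 N) ℍ := Quotient.mk _
  have hmk : ∀ a b : ℍ, mk a = mk b ↔ proj N (point a) = proj N (point b) :=
    fun a b => by
      rw [Quotient.eq, MulAction.orbitRel_apply, MulAction.mem_orbit_iff, proj_point_eq_iff]
      simp [Subgroup.smul_def]
  obtain ⟨U, V, hU, hV, hz, hw, hUV⟩ := t2_separation (mt (hmk z w).1 h)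
  have hc : Continuous mk := continuous_quotient_mk'
  refine disjoint_nhds_proj (U := point '' (mk ⁻¹' U)) (V := point '' (mk ⁻¹' V))
    (isOpenEmbedding_point.isOpenMap.image_mem_nhds ((hU.preimage hc).mem_nhds hz))
    (isOpenEmbedding_point.isOpenMap.image_mem_nhds ((hV.preimage hc).mem_nhds hw)) ?_
  rintro _ ⟨a, ha, rfl⟩ _ ⟨b, hb, rfl⟩ hab
  exact hUV.ne_of_mem ha hb ((hmk a b).2 hab)

lemma disjoint_nhds_proj_cusp_point (c : OnePoint ℚ) (z : ℍ) :
    Disjoint (𝓝 (proj N (cusp c))) (𝓝 (proj N (point z))) := by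
  obtain ⟨v, hv, rfl⟩ := exists_cuspOf c
  have hv0 := ne_zero_of_isCoprime hv
  set T := max z.im z.im⁻¹ + 1
  have hT : IsOpen {w : ℍ | max w.im w.im⁻¹ < T} := isOpen_lt
    (UpperHalfPlane.continuous_im.max (UpperHalfPlane.continuous_im.inv₀ fun w => w.im_ne_zero))
    continuous_const
  refine disjoint_nhds_proj (cuspNhd_mem_nhds hv0 T)
    (isOpenEmbedding_point.isOpenMap.image_mem_nhds (hT.mem_nhds (lt_add_one (max z.im z.im⁻¹)))) ?_
  rintro _ (rfl | ⟨a, ha, rfl⟩) _ ⟨b, hb, rfl⟩ hab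
  · exact proj_cusp_ne_point _ _ hab
  · obtain ⟨g, -, rfl⟩ := proj_point_eq_iff.1 hab.symm
    rw [Set.mem_ofPred_eq, ← height_SL_smul g] at ha
    exact (ha.trans_le (height_le ((smul_ne_zero_iff_ne g).2 hv0) _)).not_gt hb

lemma disjoint_nhds_proj_cusp {c d : OnePoint ℚ} (h : proj N (cusp c) ≠ proj N (cusp d)) :
    Disjoint (𝓝 (proj N (cusp c))) (𝓝 (proj N (cusp d))) := by
  obtain ⟨v, hv, rfl⟩ := exists_cuspOf c
  obtain ⟨w, hw, rfl⟩ := exists_cuspOf d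
  have hv0 := ne_zero_of_isCoprime hv
  have hw0 := ne_zero_of_isCoprime hw
  refine disjoint_nhds_proj (cuspNhd_mem_nhds hv0 1) (cuspNhd_mem_nhds hw0 1) ?_
  rintro _ (rfl | ⟨a, ha, rfl⟩) _ (rfl | ⟨b, hb, rfl⟩) hab
  · exact h hab
  · exact proj_cusp_ne_point _ _ hab
  · exact proj_cusp_ne_point _ _ hab.symm
  · obtain ⟨g, hg, rfl⟩ := proj_point_eq_iff.1 hab
    rw [Set.mem_ofPred_eq, ← height_SL_smul g] at hb
    have hgw := cuspOf_eq_of_one_lt_height hv0 ((smul_ne_zero_iff_ne g).2 hw0) ha hb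
    exact h (proj_cusp_eq_iff.2 ⟨g, hg, by rw [hgw, moveCusp_cuspOf g hw0]⟩)

instance (N : ℕ) : T2Space (X0 N) := by
  refine t2Space_iff_disjoint_nhds.2 fun a b => ?_
  induction a, b using Quotient.inductionOn₂ with | h x y =>
  cases x with
  | point z =>
    cases y with
    | point w => exact disjoint_nhds_proj_point
    | cusp d => exact fun _ => (disjoint_nhds_proj_cusp_point d z).symm
  | cusp c =>
    cases y with
    | point w => exact fun _ => disjoint_nhds_proj_cusp_point c w
    | cusp d => exact disjoint_nhds_proj_cusp

end Separation

section Geodesics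

open Complex

variable {v w : Fin 2 → ℤ}

lemma re_linForm_mul_conj (v w : Fin 2 → ℤ) (z : ℍ) :
    (linForm v z * (starRingEnd ℂ) (linForm w z)).re =
      v 1 * w 1 * (z.re ^ 2 + z.im ^ 2) - (v 0 * w 1 + w 0 * v 1) * z.re + v 0 * w 0 := by
  simp [linForm]
  ring

lemma geodesic_comm (a b : OnePoint ℚ) : geodesic a b = geodesic b a := by
  cases a <;> cases b <;> simp [geodesic, add_comm, abs_sub_comm]

lemma mem_geodesic_infty (h : v 1 = 0) (h0 : v 0 ≠ 0) (hw : w 1 ≠ 0) (z : ℍ) :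
    z ∈ geodesic (cuspOf v) (cuspOf w) ↔
      (linForm v z * (starRingEnd ℂ) (linForm w z)).re = 0 := by
  have h0' : (v 0 : ℝ) ≠ 0 := by exact_mod_cast h0
  have hw' : (w 1 : ℝ) ≠ 0 := by exact_mod_cast hw
  rw [re_linForm_mul_conj, cuspOf, cuspOf, if_pos h, if_neg hw, geodesic, OnePoint.elim_infty,
    OnePoint.elim_some, Set.mem_ofPred_eq]
  push_cast
  rw [h, Int.cast_zero, eq_div_iff hw', ← sub_eq_zero, ← mul_right_inj' h0']
  constructor <;> intro h <;> linear_combination -h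

lemma mem_geodesic_coe (hv : v 1 ≠ 0) (hw : w 1 ≠ 0) (z : ℍ) :
    z ∈ geodesic (cuspOf v) (cuspOf w) ↔
      (linForm v z * (starRingEnd ℂ) (linForm w z)).re = 0 := by
  have hv' : (v 1 : ℝ) ≠ 0 := by exact_mod_cast hv
  have hw' : (w 1 : ℝ) ≠ 0 := by exact_mod_cast hw
  rw [re_linForm_mul_conj, cuspOf, cuspOf, if_neg hv, if_neg hw, geodesic, OnePoint.elim_some,
    OnePoint.elim_some, Set.mem_ofPred_eq, ← sq_eq_sq₀ (norm_nonneg _) (by positivity), div_pow,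
    sq_abs, Complex.sq_norm, ← sub_eq_zero]
  have hre : ((z : ℂ) - (((v 0 / v 1 : ℚ) : ℂ) + ((w 0 / w 1 : ℚ) : ℂ)) / 2).re =
      z.re - (v 0 / v 1 + w 0 / w 1) / 2 := by
    simp
  have him : ((z : ℂ) - (((v 0 / v 1 : ℚ) : ℂ) + ((w 0 / w 1 : ℚ) : ℂ)) / 2).im = z.im := by
    simp
  rw [iff_comm, ← div_left_inj' (mul_ne_zero hv' hw'), zero_div, normSq_apply, hre, him]
  push_cast
  congr! 1
  field

lemma mem_geodesic_cuspOf (h : v 0 * w 1 - w 0 * v 1 ≠ 0) (z : ℍ) :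
    z ∈ geodesic (cuspOf v) (cuspOf w) ↔
      (linForm v z * (starRingEnd ℂ) (linForm w z)).re = 0 := by
  by_cases hv : v 1 = 0 <;> by_cases hw : w 1 = 0
  · simp [hv, hw] at h
  · exact mem_geodesic_infty hv (fun h0 => h (by simp [hv, h0])) hw z
  · rw [geodesic_comm, mem_geodesic_infty hw (fun h0 => h (by simp [hw, h0])) hv,
      ← conj_re, map_mul, conj_conj, mul_comm]
  · exact mem_geodesic_coe hv hw z

variable {M : Matrix (Fin 2) (Fin 2) ℤ} (hM : 0 < M.det)

include hM in
lemma col_ne_zero (j : Fin 2) : M.col j ≠ 0 := fun h =>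
  hM.ne' (Matrix.det_eq_zero_of_column_eq_zero j (congrFun h))

lemma linForm_single_zero (z : ℍ) : linForm (Pi.single 0 1) z = -1 := by
  simp [linForm]

lemma linForm_single_one (z : ℍ) : linForm (Pi.single 1 1) z = z := by
  simp [linForm]

lemma toGL_smul_mem_geodesic (z : ℍ) :
    toGL hM • z ∈ geodesic (cuspOf (M.col 0)) (cuspOf (M.col 1)) ↔ z.re = 0 := by
  have hd := normSq_pos.2 (UpperHalfPlane.denom_ne_zero (toGL hM) z)
  have h0 := linForm_smul hM (Pi.single 0 1) z
  have h1 := linForm_smul hM (Pi.single 1 1) z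
  rw [Matrix.mulVec_single_one, linForm_single_zero] at h0
  rw [Matrix.mulVec_single_one, linForm_single_one] at h1
  have hM' : (M.det : ℝ) ≠ 0 := by exact_mod_cast hM.ne'
  have key : (linForm (M.col 0) (toGL hM • z) * (starRingEnd ℂ) (linForm (M.col 1)
      (toGL hM • z))).re * normSq (UpperHalfPlane.denom (toGL hM) z) = -M.det ^ 2 * z.re := by
    rw [← re_mul_ofReal, ← mul_conj, mul_mul_mul_comm, ← map_mul, h0, h1, map_mul]
    simp
    ring
  rw [mem_geodesic_cuspOf (by simpa [Matrix.det_fin_two, mul_comm] using hM.ne'),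
    ← mul_left_inj' hd.ne', key, zero_mul, mul_eq_zero, or_iff_right (by simpa using hM')]

/-- The point `i e^r` of the imaginary axis. -/
noncomputable def expI (r : ℝ) : ℍ :=
  ⟨Real.exp r * I, by rw [im_ofReal_mul, I_im, mul_one]; exact Real.exp_pos r⟩

lemma expI_re (r : ℝ) : (expI r).re = 0 :=
  (re_ofReal_mul _ _).trans (by simp)

lemma expI_im (r : ℝ) : (expI r).im = Real.exp r :=
  (im_ofReal_mul _ _).trans (by simp)

lemma re_eq_zero_iff {z : ℍ} : z.re = 0 ↔ ∃ r, expI r = z := by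
  refine ⟨fun hz => ⟨Real.log z.im, UpperHalfPlane.ext_re_im ?_ ?_⟩, ?_⟩
  · rw [hz, expI_re]
  · rw [expI_im, Real.exp_log z.im_pos]
  · rintro ⟨r, rfl⟩
    exact expI_re r

lemma expI_injective : Function.Injective expI := fun r s h => by
  simpa [expI_im] using congrArg UpperHalfPlane.im h

lemma toGL_smul_expI_mem (r : ℝ) :
    toGL hM • expI r ∈ geodesic (cuspOf (M.col 0)) (cuspOf (M.col 1)) :=
  (toGL_smul_mem_geodesic hM _).2 (expI_re r)

/-- The complete geodesic from `cuspOf (M.col 1)` to `cuspOf (M.col 0)` with its endpoints,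
parametrized by the extended real line: the image under `M` of the imaginary axis. -/
noncomputable def geodesicMap (x : EReal) : ExtHalfPlane :=
  x.rec (cusp (cuspOf (M.col 1))) (fun r => point (toGL hM • expI r)) (cusp (cuspOf (M.col 0)))

lemma geodesicMap_coe (r : ℝ) : geodesicMap hM r = point (toGL hM • expI r) := rfl

lemma geodesicMap_top : geodesicMap hM ⊤ = cusp (cuspOf (M.col 0)) := rfl

lemma geodesicMap_bot : geodesicMap hM ⊥ = cusp (cuspOf (M.col 1)) := rfl

lemma range_geodesicMap :
    Set.range (geodesicMap hM) = closedGeodesic (cuspOf (M.col 0)) (cuspOf (M.col 1)) := by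
  have hmem (z : ℍ) : z ∈ geodesic (cuspOf (M.col 0)) (cuspOf (M.col 1)) ↔
      ∃ r, toGL hM • expI r = z := by
    obtain ⟨z, rfl⟩ := MulAction.surjective (toGL hM) z
    simp only [toGL_smul_mem_geodesic, re_eq_zero_iff, smul_left_cancel_iff]
  ext a
  simp only [closedGeodesic, Set.mem_range, Set.mem_union, Set.mem_image, hmem, EReal.exists,
    geodesicMap_coe, geodesicMap_top, geodesicMap_bot, Set.mem_insert_iff, Set.mem_singleton_iff]
  grind

lemma height_col_zero (r : ℝ) :
    height (M.col 0) (toGL hM • expI r) = Real.exp r / M.det := by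
  rw [← Matrix.mulVec_single_one, height_smul, height, linForm_single_zero, expI_im, normSq_neg,
    map_one, div_one]

lemma height_col_one (r : ℝ) :
    height (M.col 1) (toGL hM • expI r) = Real.exp (-r) / M.det := by
  rw [← Matrix.mulVec_single_one, height_smul, height, linForm_single_one, normSq_apply]
  simp only [UpperHalfPlane.coe_re, UpperHalfPlane.coe_im, expI_re, expI_im, Real.exp_neg]
  field

lemma continuous_expI : Continuous expI := by
  refine UpperHalfPlane.isEmbedding_coe.continuous_iff.2 ?_
  exact (continuous_ofReal.comp Real.continuous_exp).mul continuous_const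

open Filter Topology in
lemma continuous_geodesicMap : Continuous (geodesicMap hM) := by
  have hM' : (0 : ℝ) < M.det := by exact_mod_cast hM
  refine continuous_iff_continuousAt.2 fun x => ?_
  induction x with
  | bot =>
    rw [continuousAt_iff_punctured_nhds, EReal.nhdsWithin_bot, tendsto_map'_iff]
    refine tendsto_point_nhds_cusp (col_ne_zero hM 1) ?_
    simp only [height_col_one]
    exact (Real.tendsto_exp_atTop.comp tendsto_neg_atBot_atTop).atTop_div_const hM'
  | coe r =>
    rw [ContinuousAt, EReal.nhds_coe, tendsto_map'_iff]
    refine (isOpenEmbedding_point.continuous.comp ?_).continuousAt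
    exact (continuous_const_smul (toGL hM)).comp continuous_expI
  | top =>
    rw [continuousAt_iff_punctured_nhds, EReal.nhdsWithin_top, tendsto_map'_iff]
    refine tendsto_point_nhds_cusp (col_ne_zero hM 0) ?_
    simp only [height_col_zero]
    exact Real.tendsto_exp_atTop.atTop_div_const hM'

end Geodesics

section Loops

open Function

variable {X : Type*} [TopologicalSpace X] {a b : X}

lemma isSimpleClosedCurve_of_loop [T2Space X] (γ : Path a a)
    (h : Set.InjOn γ.extend (Set.Ico 0 1)) : IsSimpleClosedCurve (Set.range γ) := by
  let f : UnitAddCircle → X := AddCircle.liftIco 1 0 γ.extend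
  have hf {t : ℝ} (ht : t ∈ Set.Ico 0 1) : f t = γ.extend t :=
    AddCircle.liftIco_coe_apply (by rwa [zero_add])
  have hcont : Continuous f :=
    AddCircle.liftIco_continuous (by simp) γ.continuous_extend.continuousOn
  have hrep (x : UnitAddCircle) : ∃ t ∈ Set.Ico (0 : ℝ) 1, (t : UnitAddCircle) = x :=
    ⟨AddCircle.equivIco 1 0 x, by simpa using (AddCircle.equivIco 1 0 x).2, AddCircle.coe_equivIco⟩
  have hinj : Injective f := fun x y hxy => by
    obtain ⟨s, hs, rfl⟩ := hrep x
    obtain ⟨t, ht, rfl⟩ := hrep y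
    rw [hf hs, hf ht] at hxy
    rw [h hs ht hxy]
  have hrange : Set.range f = Set.range γ := by
    refine (Set.range_subset_iff.2 fun x => ?_).antisymm (Set.range_subset_iff.2 fun t => ?_)
    · obtain ⟨s, hs, rfl⟩ := hrep x
      rw [hf hs, ← γ.extend_range]
      exact Set.mem_range_self s
    · rcases t.2.2.eq_or_lt with h1 | h1
      · obtain rfl : t = 1 := Subtype.ext h1
        exact ⟨(0 : ℝ), by rw [hf (by simp), γ.extend_zero, γ.target]⟩
      · exact ⟨(t : ℝ), by rw [hf ⟨t.2.1, h1⟩, γ.extend_extends']⟩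
  let e := (AddCircle.homeomorphCircle one_ne_zero).symm
  refine ⟨f ∘ e, ?_, by rw [e.surjective.range_comp, hrange]⟩
  exact (hcont.isClosedEmbedding hinj).isEmbedding.comp e.isEmbedding

lemma isSimpleClosedCurve_of_paths [T2Space X] {γ γ' : Path a b} (hγ : Injective γ)
    (hγ' : Injective γ') (h : ∀ s t, γ s = γ' t → t = 0 ∨ t = 1) :
    IsSimpleClosedCurve (Set.range γ ∪ Set.range γ') := by
  rw [← γ'.symm_range, ← Path.trans_range]
  refine isSimpleClosedCurve_of_loop _ ?_
  have key {s t : ℝ} (hs : s ∈ Set.Icc 0 1) (ht : t ∈ Set.Ioo 0 1) : γ.extend s ≠ γ'.extend t := by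
    rw [γ.extend_apply hs, γ'.extend_apply (Set.Ioo_subset_Icc_self ht)]
    intro hst
    rcases h _ _ hst with h0 | h1
    · exact ht.1.ne' (congrArg Subtype.val h0)
    · exact ht.2.ne (congrArg Subtype.val h1)
  have hinj {γ : Path a b} (hγ : Injective γ) : Set.InjOn γ.extend (Set.Icc 0 1) :=
    fun s hs t ht hst => by
      rw [γ.extend_apply hs, γ.extend_apply ht] at hst
      exact congrArg Subtype.val (hγ hst)
  rintro s ⟨hs0, hs1⟩ t ⟨ht0, ht1⟩ hst
  rcases le_or_gt s (1 / 2) with hs | hs <;> rcases le_or_gt t (1 / 2) with ht | ht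
  · rw [Path.extend_trans_of_le_half _ _ hs, Path.extend_trans_of_le_half _ _ ht] at hst
    linarith [hinj hγ (by constructor <;> linarith) (by constructor <;> linarith) hst]
  · rw [Path.extend_trans_of_le_half _ _ hs, Path.extend_trans_of_half_le _ _ ht.le,
      Path.extend_symm_apply] at hst
    exact (key (by constructor <;> linarith) (by constructor <;> linarith) hst).elim
  · rw [Path.extend_trans_of_le_half _ _ ht, Path.extend_trans_of_half_le _ _ hs.le,
      Path.extend_symm_apply] at hst
    exact (key (by constructor <;> linarith) (by constructor <;> linarith) hst.symm).elim
  · rw [Path.extend_trans_of_half_le _ _ hs.le, Path.extend_trans_of_half_le _ _ ht.le,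
      Path.extend_symm_apply, Path.extend_symm_apply] at hst
    linarith [hinj hγ' (by constructor <;> linarith) (by constructor <;> linarith) hst]

/-- The path obtained from a map on the extended real line, through an increasing homeomorphism
from the unit interval. -/
noncomputable def erealPath {f : EReal → X} (hf : Continuous f) (ha : f ⊥ = a) (hb : f ⊤ = b) :
    Path a b where
  toFun := f ∘ ENNReal.orderIsoUnitIntervalBirational.symm.trans ENNReal.logOrderIso
  continuous_toFun := hf.comp (OrderIso.continuous _)
  source' := (congrArg f (map_bot _)).trans ha
  target' := (congrArg f (map_top _)).trans hb

theorem isSimpleClosedCurve_of_ereal [T2Space X] {f g : EReal → X} (hf : Continuous f)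
    (hg : Continuous g) (hbot : f ⊥ = g ⊥) (htop : f ⊤ = g ⊤) (hfi : Injective f)
    (hgi : Injective g) (h : ∀ (x : EReal) (r : ℝ), f x ≠ g r) :
    IsSimpleClosedCurve (Set.range f ∪ Set.range g) := by
  let e := ENNReal.orderIsoUnitIntervalBirational.symm.trans ENNReal.logOrderIso
  rw [← e.surjective.range_comp f, ← e.surjective.range_comp g]
  refine isSimpleClosedCurve_of_paths (γ := erealPath hf hbot htop) (γ' := erealPath hg rfl rfl)
    (hfi.comp e.injective) (hgi.comp e.injective) fun s t hst => ?_
  have hst' : f (e s) = g (e t) := hst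
  induction ht : e t with
  | bot => exact Or.inl ((map_eq_bot_iff e).1 ht)
  | coe r => exact (h _ r (ht ▸ hst')).elim
  | top => exact Or.inr ((map_eq_top_iff e).1 ht)

end Loops

section Curves

open Function

variable {N : ℕ} {M M' : Matrix (Fin 2) (Fin 2) ℤ}

lemma injective_proj_geodesicMap (hM : 0 < M.det)
    (hne : proj N (cusp (cuspOf (M.col 0))) ≠ proj N (cusp (cuspOf (M.col 1))))
    (hinj : Set.InjOn (fun z => proj N (point z))
      (geodesic (cuspOf (M.col 0)) (cuspOf (M.col 1)))) :
    Injective (proj N ∘ geodesicMap hM) := by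
  intro x y hxy
  rw [comp_apply, comp_apply] at hxy
  induction x <;> induction y
  all_goals simp only [geodesicMap_bot, geodesicMap_coe, geodesicMap_top, hne, hne.symm,
    proj_cusp_ne_point, (proj_cusp_ne_point _ _).symm] at hxy ⊢
  rename_i r s
  have hrs := hinj (toGL_smul_expI_mem hM r) (toGL_smul_expI_mem hM s) hxy
  exact congrArg _ (expI_injective (MulAction.injective _ hrs))

theorem isSimpleClosedCurve_of_geodesics (hM : 0 < M.det) (hM' : 0 < M'.det)
    (h : ∀ j, proj N (cusp (cuspOf (M.col j))) = proj N (cusp (cuspOf (M'.col j))))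
    (hne : proj N (cusp (cuspOf (M.col 0))) ≠ proj N (cusp (cuspOf (M.col 1))))
    (hinj : Set.InjOn (fun z => proj N (point z)) (geodesic (cuspOf (M.col 0)) (cuspOf (M.col 1)) ∪
      geodesic (cuspOf (M'.col 0)) (cuspOf (M'.col 1))))
    (hdisj : Disjoint (geodesic (cuspOf (M.col 0)) (cuspOf (M.col 1)))
      (geodesic (cuspOf (M'.col 0)) (cuspOf (M'.col 1)))) :
    IsSimpleClosedCurve (proj N '' (closedGeodesic (cuspOf (M.col 0)) (cuspOf (M.col 1)) ∪
      closedGeodesic (cuspOf (M'.col 0)) (cuspOf (M'.col 1)))) := by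
  rw [← range_geodesicMap hM, ← range_geodesicMap hM', Set.image_union, ← Set.range_comp,
    ← Set.range_comp]
  refine isSimpleClosedCurve_of_ereal ((continuous_proj N).comp (continuous_geodesicMap hM))
    ((continuous_proj N).comp (continuous_geodesicMap hM')) (h 1) (h 0)
    (injective_proj_geodesicMap hM hne (hinj.mono Set.subset_union_left))
    (injective_proj_geodesicMap hM' (by rwa [← h, ← h]) (hinj.mono Set.subset_union_right))
    fun x r hxr => ?_
  induction x with
  | bot => exact proj_cusp_ne_point _ _ hxr
  | coe s =>
    have hmem := toGL_smul_expI_mem hM s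
    have heq := hinj (Or.inl hmem) (Or.inr (toGL_smul_expI_mem hM' r)) hxr
    exact Set.disjoint_left.1 hdisj hmem (heq ▸ toGL_smul_expI_mem hM' r)
  | top => exact proj_cusp_ne_point _ _ hxr

end Curves

section Conjugation

open ModularGroup

variable {N : ℕ} {g g' h h' h'' : SL(2, ℤ)}

lemma eq_one_or_neg_one_of_scalar (h00 : g 0 0 = g 1 1) (h01 : g 0 1 = 0) (h10 : g 1 0 = 0) :
    g = 1 ∨ g = -1 := by
  have hd := det_eq_one g
  rw [h00, h01, zero_mul, sub_zero] at hd
  refine (mul_self_eq_one_iff.1 hd).imp (fun h11 => ?_) fun h11 => ?_ <;>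
  · ext i j
    fin_cases i <;> fin_cases j <;> simp [h00, h01, h10, h11]

lemma eq_T_zpow (h00 : g 0 0 = 1) (h10 : g 1 0 = 0) : g = T ^ g 0 1 := by
  have h11 : g 1 1 = 1 := by simpa [h00, h10] using det_eq_one g
  ext i j
  fin_cases i <;> fin_cases j <;> simp [coe_T_zpow, h00, h10, h11]

lemma hat_mul (g h : SL(2, ℤ)) : hat (g * h) = hat g * hat h := by
  ext i j
  change !![_, _; _, _] i j = (!![_, _; _, _] * !![_, _; _, _] : Matrix _ _ ℤ) i j
  simp only [Matrix.SpecialLinearGroup.coe_mul, Matrix.mul_apply, Fin.sum_univ_two]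
  fin_cases i <;> fin_cases j <;> simp [add_comm]

lemma hat_inv (g : SL(2, ℤ)) : hat g⁻¹ = (hat g)⁻¹ := map_inv (MonoidHom.mk' hat hat_mul) g

lemma hat_T_zpow (m : ℤ) : hat (T ^ m) = T ^ (-m) := by
  ext i j
  fin_cases i <;> fin_cases j <;> simp [hat, coe_T_zpow]

/-- The reflections `hσ` and `h'σ` of `ℍ`, where `σ` is `z ↦ -conj z`, are conjugate by `g`; as
`σ g⁻¹ σ = (hat g)⁻¹`, this says `h = g h' (hat g)⁻¹`. -/
def ReflConj (g h h' : SL(2, ℤ)) : Prop := h * hat g = g * h'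

namespace ReflConj

lemma symm (hg : ReflConj g h h') : ReflConj g⁻¹ h' h := by
  rw [ReflConj, hat_inv, mul_inv_eq_iff_eq_mul, mul_assoc, hg, inv_mul_cancel_left]

lemma trans (hg : ReflConj g h h') (hg' : ReflConj g' h' h'') : ReflConj (g * g') h h'' := by
  rw [ReflConj, hat_mul, ← mul_assoc, hg, mul_assoc, hg', mul_assoc]

lemma entries (hg : ReflConj g h h') :
    h 0 0 * g 0 0 - h 0 1 * g 1 0 = g 0 0 * h' 0 0 + g 0 1 * h' 1 0 ∧
    h 1 0 * g 0 0 - h 1 1 * g 1 0 = g 1 0 * h' 0 0 + g 1 1 * h' 1 0 ∧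
    h 0 1 * g 1 1 - h 0 0 * g 0 1 = g 0 0 * h' 0 1 + g 0 1 * h' 1 1 ∧
    h 1 1 * g 1 1 - h 1 0 * g 0 1 = g 1 0 * h' 0 1 + g 1 1 * h' 1 1 := by
  have hmul : h.1 * !![g 0 0, -g 0 1; -g 1 0, g 1 1] = g.1 * h'.1 := congrArg Subtype.val hg
  have h_entry (i j : Fin 2) := congrFun₂ hmul i j
  simp only [Matrix.mul_apply, Fin.sum_univ_two, Fin.forall_fin_two, Matrix.of_apply,
    Matrix.cons_val] at h_entry
  obtain ⟨⟨h00, h01⟩, h10, h11⟩ := h_entry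
  refine ⟨?_, ?_, ?_, ?_⟩ <;> linarith

lemma mem_Gamma_two_iff (hg : ReflConj g h h') :
    h ∈ CongruenceSubgroup.Gamma 2 ↔ h' ∈ CongruenceSubgroup.Gamma 2 := by
  let r := Matrix.SpecialLinearGroup.map (n := Fin 2) (Int.castRingHom (ZMod 2))
  have hhat : r (hat g) = r g := by
    ext i j
    change ((hat g i j : ℤ) : ZMod 2) = (g i j : ℤ)
    fin_cases i <;> fin_cases j <;> simp [hat, ZMod.neg_eq_self_mod_two]
  have hr : r h * r g = r g * r h' := by simpa only [map_mul, hhat] using congrArg r hg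
  change r h = 1 ↔ r h' = 1
  constructor <;> intro h1
  · rwa [h1, one_mul, left_eq_mul] at hr
  · rwa [h1, mul_one, mul_eq_right] at hr

end ReflConj

lemma T_zpow_mem_Gamma_two_iff {n : ℤ} : T ^ n ∈ CongruenceSubgroup.Gamma 2 ↔ Even n := by
  simp [coe_T_zpow, ZMod.intCast_zmod_eq_zero_iff_dvd, even_iff_two_dvd]

lemma neg_mem_Gamma_two_iff :
    -h ∈ CongruenceSubgroup.Gamma 2 ↔ h ∈ CongruenceSubgroup.Gamma 2 := by
  simp [ZMod.neg_eq_self_mod_two]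

lemma reflConj_T_zpow (m n : ℤ) : ReflConj (T ^ m) (T ^ (n + 2 * m)) (T ^ n) := by
  rw [ReflConj, hat_T_zpow, ← zpow_add, ← zpow_add]
  ring_nf

lemma exists_eigenvector {a b c : ℤ} (h : a ^ 2 - b * c = 1) :
    ∃ x y : ℤ, IsCoprime x y ∧ a * x - b * y = x ∧ c * x - a * y = y := by
  obtain ⟨x, y, hxy, h0, h1⟩ :
      ∃ x y : ℤ, 0 < Int.gcd x y ∧ a * x - b * y = x ∧ c * x - a * y = y := by
    by_cases hc : a + 1 = 0 ∧ c = 0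
    · exact ⟨b, a - 1, Int.gcd_pos_iff.2 (by omega), by ring, by linear_combination -h⟩
    · exact ⟨a + 1, c, Int.gcd_pos_iff.2 (by omega), by linear_combination h, by ring⟩
  obtain ⟨x', y', hgcd, hx, hy⟩ := Int.exists_gcd_one hxy
  have hne : (Int.gcd x y : ℤ) ≠ 0 := by positivity
  generalize (Int.gcd x y : ℤ) = d at *
  subst hx hy
  refine ⟨x', y', Int.isCoprime_iff_gcd_eq_one.2 hgcd, mul_right_cancel₀ hne ?_,
    mul_right_cancel₀ hne ?_⟩
  · linear_combination h0
  · linear_combination h1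

lemma exists_reflConj_T_zpow (hdiag : h 0 0 = h 1 1) :
    ∃ (g : SL(2, ℤ)) (n : ℤ), ReflConj g h (T ^ n) := by
  obtain ⟨x, y, hxy, h0, h1⟩ := exists_eigenvector (a := h 0 0) (b := h 0 1) (c := h 1 0)
    (by linear_combination det_eq_one h + h 0 0 * hdiag)
  obtain ⟨g, rfl, rfl⟩ := hxy.exists_SL2_col 0
  obtain ⟨k, hconj⟩ : ∃ k, ReflConj g h k := ⟨g⁻¹ * (h * hat g), (mul_inv_cancel_left g _).symm⟩
  have hg := det_eq_one g
  obtain ⟨e0, e1, -⟩ := hconj.entries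
  rw [h0] at e0
  rw [← hdiag, h1] at e1
  have hk : k = T ^ k 0 1 := eq_T_zpow
    (by linear_combination (1 - k 0 0) * hg - g 1 1 * e0 + g 0 1 * e1)
    (by linear_combination - k 1 0 * hg + g 1 0 * e0 - g 0 0 * e1)
  exact ⟨g, _, hk ▸ hconj⟩

lemma ReflConj.eq_one_or_neg_one_of_T_zpow {n : ℤ} (hg : ReflConj g (T ^ n) (T ^ n)) :
    g = 1 ∨ g = -1 := by
  obtain ⟨-, h10, h01, -⟩ := hg.entries
  simp only [coe_T_zpow, Matrix.of_apply, Matrix.cons_val] at h10 h01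
  have g10 : g 1 0 = 0 := by linarith
  have h00 : g 0 0 = g 1 1 := by
    have hd := det_eq_one g
    rw [g10, mul_zero, sub_zero] at hd
    rcases Int.mul_eq_one_iff_eq_one_or_neg_one.1 hd with ⟨h0, h1⟩ | ⟨h0, h1⟩ <;> rw [h0, h1]
  exact eq_one_or_neg_one_of_scalar h00 (by rw [h00] at h01; linarith) g10

lemma ReflConj.eq_one_or_neg_one (hdiag : h 0 0 = h 1 1) (hg : ReflConj g h h) :
    g = 1 ∨ g = -1 := by
  obtain ⟨γ, n, hγ⟩ := exists_reflConj_T_zpow hdiag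
  refine ((hγ.symm.trans hg).trans hγ).eq_one_or_neg_one_of_T_zpow.imp (fun h1 => ?_) fun h1 => ?_
  · simpa [mul_assoc, inv_mul_eq_one] using h1
  · rw [mul_assoc, inv_mul_eq_iff_eq_mul, mul_neg_one, ← neg_one_mul] at h1
    exact mul_right_cancel h1

end Conjugation

section CongruenceConjugation

open ModularGroup

variable {N : ℕ} {g h h' : SL(2, ℤ)}

lemma isUnit_cast_of_mem_Gamma0 (hg : g ∈ Gamma0 N) : IsUnit (g 0 0 : ZMod N) := by
  have hd := congrArg (Int.cast : ℤ → ZMod N) (det_eq_one g)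
  push_cast [Gamma0_mem.1 hg] at hd
  exact .of_mul_eq_one (g 1 1 : ZMod N) (by linear_combination hd)

lemma cast_mul_self_eq_one (hdiag : h 0 0 = h 1 1) (hh : h ∈ Gamma0 N) :
    (h 0 0 : ZMod N) * h 0 0 = 1 := by
  have hd := congrArg (Int.cast : ℤ → ZMod N) (det_eq_one h)
  push_cast [Gamma0_mem.1 hh, ← hdiag] at hd
  linear_combination hd

lemma ReflConj.cast_eq (hgN : g ∈ Gamma0 N) (hh' : h' ∈ Gamma0 N) (hg : ReflConj g h h') :
    (h 0 0 : ZMod N) = h' 0 0 := by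
  have e0 := congrArg (Int.cast : ℤ → ZMod N) hg.entries.1
  push_cast [Gamma0_mem.1 hgN, Gamma0_mem.1 hh'] at e0
  exact (isUnit_cast_of_mem_Gamma0 hgN).mul_left_cancel (by linear_combination e0)

lemma isUnit_two_of_odd (hN : Odd N) : IsUnit (2 : ZMod N) := by
  exact_mod_cast (ZMod.unitOfCoprime 2 (Nat.coprime_two_left.2 hN)).isUnit

lemma ReflConj.mem_Gamma0 (hN : Odd N) (hdiag : h 0 0 = h 1 1) (hh : h ∈ Gamma0 N)
    (hh' : h' ∈ Gamma0 N) (hcast : (h 0 0 : ZMod N) = h' 0 0) (hg : ReflConj g h h') :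
    g ∈ Gamma0 N := by
  have e1 := congrArg (Int.cast : ℤ → ZMod N) hg.entries.2.1
  push_cast [Gamma0_mem.1 hh, Gamma0_mem.1 hh', ← hdiag, ← hcast] at e1
  have hunit := (isUnit_two_of_odd hN).mul (isUnit_cast_of_mem_Gamma0 hh)
  exact Gamma0_mem.2 (hunit.mul_left_cancel (by linear_combination -e1))

lemma exists_mem_Gamma0_reflConj (hN : Odd N) (hh : h ∈ Gamma0 N) (hh' : h' ∈ Gamma0 N)
    (hdiag : h 0 0 = h 1 1) (hdiag' : h' 0 0 = h' 1 1) (hcast : (h 0 0 : ZMod N) = h' 0 0)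
    (htwo : h ∈ CongruenceSubgroup.Gamma 2 ↔ h' ∈ CongruenceSubgroup.Gamma 2) :
    ∃ g ∈ Gamma0 N, ReflConj g h h' := by
  obtain ⟨γ, n, hγ⟩ := exists_reflConj_T_zpow hdiag
  obtain ⟨γ', n', hγ'⟩ := exists_reflConj_T_zpow hdiag'
  rw [hγ.mem_Gamma_two_iff, hγ'.mem_Gamma_two_iff, T_zpow_mem_Gamma_two_iff,
    T_zpow_mem_Gamma_two_iff, ← Int.even_sub] at htwo
  obtain ⟨m, hm⟩ := htwo
  have hT : ReflConj (T ^ m) (T ^ n) (T ^ n') := by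
    simpa only [show n' + 2 * m = n by omega] using reflConj_T_zpow m n'
  have hconj := (hγ.trans hT).trans hγ'.symm
  exact ⟨_, hconj.mem_Gamma0 hN hdiag hh hh' hcast, hconj⟩

end CongruenceConjugation

section Mirrors

open Complex
open Matrix.SpecialLinearGroup (mapGL mapGL_coe_matrix map_apply_coe)

variable {N : ℕ} {g h h' : SL(2, ℤ)} {z w : ℍ}

/-- The restriction of the reflection `σ` to `ℍ`, namely `z ↦ -conj z`. -/
def reflPoint (z : ℍ) : ℍ := ⟨-(starRingEnd ℂ) (z : ℂ), by simpa using z.im_pos⟩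

lemma refl_point (z : ℍ) : refl (point z) = point (reflPoint z) := rfl

lemma reflPoint_smul (g : SL(2, ℤ)) (z : ℍ) : reflPoint (g • z) = hat g • reflPoint z :=
  point.inj (refl_smul g (point z))

/-- The mirror of `hσ`: the set of points of `ℍ` fixed by `hσ`. It is empty unless `h` has equal
diagonal entries. -/
def mirror (h : SL(2, ℤ)) : Set ℍ := {z | h • reflPoint z = z}

lemma mem_mirror_iff : z ∈ mirror h ↔ h 0 0 = h 1 1 ∧
    (h 1 0 * (z.re ^ 2 + z.im ^ 2) - 2 * h 0 0 * z.re + h 0 1 : ℝ) = 0 := by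
  have hz := z.im_pos
  have hfix : h • reflPoint z = z ↔
      (h 0 0 * -(starRingEnd ℂ) (z : ℂ) + h 0 1 : ℂ) =
        z * (h 1 0 * -(starRingEnd ℂ) (z : ℂ) + h 1 1) := by
    refine (UpperHalfPlane.gl_smul_eq_iff_num_eq (g := mapGL ℝ h)).trans ?_
    simp [UpperHalfPlane.num, UpperHalfPlane.denom, UpperHalfPlane.σ, reflPoint]
  change h • reflPoint z = z ↔ _
  rw [hfix, Complex.ext_iff, ← Int.cast_inj (α := ℝ)]
  simp only [mul_neg, add_re, neg_re, mul_re, intCast_re, conj_re, UpperHalfPlane.coe_re,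
    intCast_im, conj_im, UpperHalfPlane.coe_im, zero_mul, neg_zero, sub_zero, add_im, neg_im,
    mul_im, add_zero, neg_neg]
  refine ⟨fun ⟨hre, him⟩ => ?_, fun ⟨hdiag, hq⟩ =>
    ⟨by linear_combination hq + z.re * hdiag, by linear_combination z.im * hdiag⟩⟩
  have hdiag : (h 0 0 : ℝ) = h 1 1 := mul_right_cancel₀ hz.ne' (by linear_combination him)
  exact ⟨hdiag, by linear_combination hre - z.re * hdiag⟩

lemma ReflConj.smul_mem_mirror (hg : ReflConj g h h') : g • z ∈ mirror h ↔ z ∈ mirror h' := by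
  change h • reflPoint (g • z) = g • z ↔ h' • reflPoint z = z
  rw [reflPoint_smul, ← mul_smul, hg, mul_smul, smul_left_cancel_iff]

lemma mirror_neg : mirror (-h) = mirror h := by
  ext z
  simp [mirror]

lemma diag_eq_of_mem_mirror (hz : z ∈ mirror h) : h 0 0 = h 1 1 := (mem_mirror_iff.1 hz).1

lemma eq_one_or_neg_one_of_smul_eq_self (hg : g • z = z) (htr : 4 ≤ (g 0 0 + g 1 1) ^ 2) :
    g = 1 ∨ g = -1 := by
  have hcenter : mapGL ℝ g ∈ Subgroup.center (GL (Fin 2) ℝ) := by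
    by_contra hc
    have hdet : (mapGL ℝ g).1.det = 1 :=
      congrArg Units.val (Matrix.SpecialLinearGroup.det_mapGL g)
    have hell := UpperHalfPlane.isElliptic_of_exists_smul_eq_self (by rw [hdet]; exact one_pos)
      hc ⟨z, hg⟩
    have htr' : (4 : ℝ) ≤ (g 0 0 + g 1 1) ^ 2 := by exact_mod_cast htr
    rw [Matrix.GeneralLinearGroup.IsElliptic, Matrix.IsElliptic, Matrix.discr_fin_two, hdet,
      Matrix.trace_fin_two] at hell
    simp only [mapGL_coe_matrix, algebraMap_int_eq, map_apply_coe, RingHom.mapMatrix_apply,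
      Int.coe_castRingHom, Matrix.map_apply, mul_one, sub_neg] at hell
    linarith
  obtain ⟨r, hr⟩ := Matrix.GeneralLinearGroup.mem_center_iff_val_mem_range_scalar.1 hcenter
  have hentry (i j : Fin 2) := congrFun₂ hr i j
  simp only [Matrix.scalar_apply, mapGL_coe_matrix, algebraMap_int_eq, map_apply_coe,
    RingHom.mapMatrix_apply, Int.coe_castRingHom, Matrix.map_apply, Fin.forall_fin_two,
    Matrix.diagonal_apply_eq, ne_eq, zero_ne_one, not_false_eq_true, Matrix.diagonal_apply_ne,
    one_ne_zero] at hentry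
  obtain ⟨⟨h00, h01⟩, h10, h11⟩ := hentry
  exact eq_one_or_neg_one_of_scalar (mod_cast h00.symm.trans h11) (mod_cast h01.symm)
    (mod_cast h10.symm)

lemma four_le_sq_of_cast_sq_eq (hN : 4 < N) {t : ℤ} (ht : (t : ZMod N) ^ 2 = 4) : 4 ≤ t ^ 2 := by
  by_contra! hlt
  have hdvd : (N : ℤ) ∣ 4 - t ^ 2 := by
    rw [← ZMod.intCast_zmod_eq_zero_iff_dvd]
    push_cast
    rw [ht, sub_self]
  have hle := Int.le_of_dvd (sub_pos.2 hlt) hdvd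
  have hsq := sq_nonneg t
  omega

/-- The trace `t` of the product of two reflections of `Γ₀(N)` satisfies `t ^ 2 ≡ 4` modulo `N`, so
`t ^ 2 ≥ 4` and the product is not elliptic. -/
lemma eq_or_eq_neg_of_mem_mirror (hN : 4 < N) (hh : h ∈ Gamma0 N) (hh' : h' ∈ Gamma0 N)
    (hz : z ∈ mirror h) (hz' : z ∈ mirror h') : h = h' ∨ h = -h' := by
  have hdiag := diag_eq_of_mem_mirror hz
  have hdiag' := diag_eq_of_mem_mirror hz'
  have hfix : (h * h'⁻¹) • z = z := by
    rw [mul_smul, show h'⁻¹ • z = reflPoint z from inv_smul_eq_iff.2 hz'.symm]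
    exact hz
  have htr : (((h * h'⁻¹) 0 0 + (h * h'⁻¹) 1 1 : ℤ) : ZMod N) = 2 * (h 0 0 * h' 0 0) := by
    simp only [Matrix.SpecialLinearGroup.coe_mul, Matrix.SpecialLinearGroup.coe_inv,
      Matrix.adjugate_fin_two, Matrix.mul_apply, Fin.sum_univ_two, Matrix.of_apply, Matrix.cons_val]
    push_cast [Gamma0_mem.1 hh, Gamma0_mem.1 hh', ← hdiag, ← hdiag']
    ring
  have htr_sq : (((h * h'⁻¹) 0 0 + (h * h'⁻¹) 1 1 : ℤ) : ZMod N) ^ 2 = 4 := by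
    rw [htr]
    linear_combination (4 * (h' 0 0 : ZMod N) ^ 2) * cast_mul_self_eq_one hdiag hh +
      4 * cast_mul_self_eq_one hdiag' hh'
  refine (eq_one_or_neg_one_of_smul_eq_self hfix (four_le_sq_of_cast_sq_eq hN htr_sq)).imp
    mul_inv_eq_one.1 fun hneg => ?_
  rw [mul_inv_eq_iff_eq_mul.1 hneg, neg_one_mul]

lemma neg_mem_Gamma0 (hh : h ∈ Gamma0 N) : -h ∈ Gamma0 N := by
  simpa [Gamma0_mem] using hh

lemma reflConj_of_smul_mem_mirror (hN : 4 < N) (hh : h ∈ Gamma0 N) (hh' : h' ∈ Gamma0 N)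
    (hg : g ∈ Gamma0 N) (hgz : g • z ∈ mirror h) (hz : z ∈ mirror h') :
    ReflConj g h h' ∨ ReflConj g (-h) h' := by
  have hconj : ReflConj g (g * h' * (hat g)⁻¹) h' := inv_mul_cancel_right _ _
  have hmem : g * h' * (hat g)⁻¹ ∈ Gamma0 N := mul_mem (mul_mem hg hh') (inv_mem (hat_mem hg))
  refine (eq_or_eq_neg_of_mem_mirror hN hh hmem hgz (hconj.smul_mem_mirror.2 hz)).imp
    (fun heq => ?_) fun heq => ?_
  · rwa [heq]
  · rwa [heq, neg_neg]

lemma injOn_proj_mirror (hN : 4 < N) (hodd : Odd N) (hh : h ∈ Gamma0 N) :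
    Set.InjOn (fun z => proj N (point z)) (mirror h) := by
  intro z hz w hw hzw
  obtain ⟨g, hg, rfl⟩ := proj_point_eq_iff.1 hzw
  rcases reflConj_of_smul_mem_mirror hN hh hh hg hz hw with hconj | hconj
  · rcases hconj.eq_one_or_neg_one (diag_eq_of_mem_mirror hw) with rfl | rfl
    · exact one_smul _ w
    · simp
  · have hcast := hconj.cast_eq hg hh
    push_cast [Matrix.SpecialLinearGroup.coe_neg, Matrix.neg_apply] at hcast
    have hunit := (isUnit_two_of_odd hodd).mul (isUnit_cast_of_mem_Gamma0 hh)
    have : Fact (1 < N) := ⟨by omega⟩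
    exact absurd (by linear_combination -hcast) hunit.ne_zero

lemma cast_eq_and_mem_Gamma_two_iff_of_proj_eq (hN : 4 < N) (hh : h ∈ Gamma0 N)
    (hh' : h' ∈ Gamma0 N) (hz : z ∈ mirror h) (hw : w ∈ mirror h')
    (hzw : proj N (point z) = proj N (point w)) :
    ((h 0 0 : ZMod N) = h' 0 0 ∨ (h 0 0 : ZMod N) = -h' 0 0) ∧
      (h ∈ CongruenceSubgroup.Gamma 2 ↔ h' ∈ CongruenceSubgroup.Gamma 2) := by
  obtain ⟨g, hg, rfl⟩ := proj_point_eq_iff.1 hzw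
  rcases reflConj_of_smul_mem_mirror hN hh hh' hg hz hw with hconj | hconj
  · exact ⟨.inl (hconj.cast_eq hg hh'), hconj.mem_Gamma_two_iff⟩
  · refine ⟨.inr ?_, neg_mem_Gamma_two_iff.symm.trans hconj.mem_Gamma_two_iff⟩
    simpa [neg_eq_iff_eq_neg] using hconj.cast_eq hg hh'

lemma exists_mem_mirror_proj_eq (hN : Odd N) (hh : h ∈ Gamma0 N) (hh' : h' ∈ Gamma0 N)
    (hdiag' : h' 0 0 = h' 1 1)
    (hcast : (h 0 0 : ZMod N) = h' 0 0 ∨ (h 0 0 : ZMod N) = -h' 0 0)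
    (htwo : h ∈ CongruenceSubgroup.Gamma 2 ↔ h' ∈ CongruenceSubgroup.Gamma 2)
    (hz : z ∈ mirror h) : ∃ w ∈ mirror h', proj N (point w) = proj N (point z) := by
  wlog hpos : (h 0 0 : ZMod N) = h' 0 0 generalizing h
  · refine this (neg_mem_Gamma0 hh) ?_ (neg_mem_Gamma_two_iff.trans htwo)
      (mirror_neg.symm ▸ hz) ?_ <;>
    simp [hcast.resolve_left hpos]
  obtain ⟨g, hg, hconj⟩ :=
    exists_mem_Gamma0_reflConj hN hh hh' (diag_eq_of_mem_mirror hz) hdiag' hpos htwo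
  exact ⟨g⁻¹ • z, hconj.symm.smul_mem_mirror.2 hz, proj_point_eq_iff.2 ⟨g⁻¹, inv_mem hg, rfl⟩⟩

lemma proj_point_mem_fixSet_iff : proj N (point z) ∈ fixSet N ↔ ∃ h ∈ Gamma0 N, z ∈ mirror h := by
  change sigma N (proj N (point z)) = proj N (point z) ↔ _
  rw [sigma_proj, refl_point, eq_comm, proj_point_eq_iff]
  rfl

lemma geodesic_eq_mirror {M : Matrix (Fin 2) (Fin 2) ℤ} (hM : 0 < M.det)
    (hh : h.1 * !![M 0 0, -M 0 1; -M 1 0, M 1 1] = M) :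
    geodesic (cuspOf (M.col 0)) (cuspOf (M.col 1)) = mirror h := by
  have hentry (i j : Fin 2) := congrFun₂ hh i j
  simp only [Matrix.mul_apply, Fin.sum_univ_two, Fin.forall_fin_two, Matrix.of_apply,
    Matrix.cons_val] at hentry
  obtain ⟨⟨e00, e01⟩, e10, e11⟩ := hentry
  have hdet := M.det_fin_two
  have h00 : M.det * h 0 0 = M 0 0 * M 1 1 + M 0 1 * M 1 0 := by
    linear_combination M 1 1 * e00 + M 1 0 * e01 + h 0 0 * hdet
  have h01 : M.det * h 0 1 = 2 * (M 0 0 * M 0 1) := by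
    linear_combination M 0 1 * e00 + M 0 0 * e01 + h 0 1 * hdet
  have h10 : M.det * h 1 0 = 2 * (M 1 0 * M 1 1) := by
    linear_combination M 1 1 * e10 + M 1 0 * e11 + h 1 0 * hdet
  have h11 : M.det * h 1 1 = M 0 0 * M 1 1 + M 0 1 * M 1 0 := by
    linear_combination M 0 1 * e10 + M 0 0 * e11 + h 1 1 * hdet
  ext z
  have hne : M.col 0 0 * M.col 1 1 - M.col 1 0 * M.col 0 1 ≠ 0 := (hdet.symm.trans_gt hM).ne'
  rw [mem_geodesic_cuspOf hne, re_linForm_mul_conj, mem_mirror_iff,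
    and_iff_right (mul_left_cancel₀ hM.ne' (h00.trans h11.symm))]
  generalize M.det = d at *
  rify at h00 h01 h10 hM
  simp only [Matrix.col_apply]
  constructor
  · intro hz
    refine mul_left_cancel₀ hM.ne' ?_
    linear_combination 2 * hz + (z.re ^ 2 + z.im ^ 2) * h10 - 2 * z.re * h00 + h01
  · intro hz
    linear_combination (d : ℝ) / 2 * hz - (z.re ^ 2 + z.im ^ 2) / 2 * h10 +
      z.re * h00 - h01 / 2

end Mirrors

section Configuration

variable {p q : ℕ} {X Y : ℤ} {i j k i' j' k' : Fin 2}

/-- The integral matrices whose columns are homogeneous coordinates of the endpoints of the four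
geodesics, for integers with `X * q - Y * p = 1`. -/
def frame (p q : ℕ) (X Y : ℤ) : Fin 2 → Fin 2 → Matrix (Fin 2) (Fin 2) ℤ :=
  ![![1, !![1, 1; 0, 2]], ![!![X, Y; p, q], !![2 * X, 2 * Y; p, q]]]

/-- The `k`-th endpoint of the `j`-th geodesic for the curve with index `i`. -/
def endpoint (p q : ℕ) (X Y : ℤ) (i j k : Fin 2) : OnePoint ℚ :=
  cuspOf ((frame p q X Y i j).col k)

/-- The elements `h` of `Γ₀(pq)` for which `hσ` is the reflection in one of the four geodesics. -/
def reflections (hXY : X * q - Y * p = 1) : Fin 2 → Fin 2 → SL(2, ℤ) :=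
  ![![1, ModularGroup.T],
    ![⟨!![X * q + Y * p, 2 * X * Y; 2 * p * q, X * q + Y * p], by
        rw [Matrix.det_fin_two_of]; linear_combination (X * q - Y * p + 1) * hXY⟩,
      ⟨!![X * q + Y * p, 4 * X * Y; p * q, X * q + Y * p], by
        rw [Matrix.det_fin_two_of]; linear_combination (X * q - Y * p + 1) * hXY⟩]]

lemma det_frame_pos (hXY : X * q - Y * p = 1) (i j : Fin 2) : 0 < (frame p q X Y i j).det := by
  fin_cases i <;> fin_cases j <;> simp [frame, Matrix.det_fin_two] <;> linarith

lemma reflections_apply_zero_zero (hXY : X * q - Y * p = 1) (i j : Fin 2) :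
    reflections hXY i j 0 0 = ![1, X * q + Y * p] i := by
  fin_cases i <;> fin_cases j <;> simp [reflections, ModularGroup.T]

lemma reflections_diag (hXY : X * q - Y * p = 1) (i j : Fin 2) :
    reflections hXY i j 0 0 = reflections hXY i j 1 1 := by
  fin_cases i <;> fin_cases j <;> simp [reflections, ModularGroup.T]

lemma reflections_mem_Gamma0 (hXY : X * q - Y * p = 1) (i j : Fin 2) :
    reflections hXY i j ∈ Gamma0 (p * q) := by
  rw [mem_Gamma0_iff_dvd]
  fin_cases i <;> fin_cases j <;> simp [reflections, ModularGroup.T, mul_assoc]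

lemma reflections_mem_Gamma_two_iff (hodd : Odd (p * q)) (hXY : X * q - Y * p = 1) :
    reflections hXY i j ∈ Gamma 2 ↔ j = 0 := by
  have h2 : (2 : ZMod 2) = 0 := by decide
  have h4 : (4 : ZMod 2) = 0 := by decide
  have hpq : (p * q : ZMod 2) = 1 := by
    exact_mod_cast ZMod.natCast_eq_one_iff_odd.2 hodd
  have hdiag : (X * q + Y * p : ZMod 2) = 1 := by
    have h := congrArg (Int.cast : ℤ → ZMod 2) hXY
    push_cast at h
    linear_combination h + Y * p * h2
  rw [Gamma_mem]
  fin_cases i <;> fin_cases j <;>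
    simp [reflections, ModularGroup.T, hdiag, h2, h4, hpq]

lemma geodesic_endpoint (hXY : X * q - Y * p = 1) (i j : Fin 2) :
    geodesic (endpoint p q X Y i j 0) (endpoint p q X Y i j 1) = mirror (reflections hXY i j) := by
  refine geodesic_eq_mirror (det_frame_pos hXY i j) ?_
  fin_cases i <;> fin_cases j <;> ext k l <;> fin_cases k <;> fin_cases l <;>
    simp [frame, reflections, ModularGroup.T, Matrix.mul_apply] <;> grind

lemma endpoint_zero_ne_one (hXY : X * q - Y * p = 1) (i j : Fin 2) :
    endpoint p q X Y i j 0 ≠ endpoint p q X Y i j 1 := by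
  have hdet := det_frame_pos hXY i j
  rw [endpoint, endpoint, Ne, cuspOf_eq_cuspOf_iff (col_ne_zero hdet 0) (col_ne_zero hdet 1)]
  rw [Matrix.det_fin_two] at hdet
  exact fun h => hdet.ne' (sub_eq_zero.2 h)

lemma cast_ne_one_and_ne_neg_one (hodd : Odd (p * q)) (hp : p ≠ 1) (hq : q ≠ 1)
    (hXY : X * q - Y * p = 1) :
    ((X * q + Y * p : ℤ) : ZMod (p * q)) ≠ 1 ∧ ((X * q + Y * p : ℤ) : ZMod (p * q)) ≠ -1 := by
  have hdvd : ∀ {m : ℕ}, Odd m → (m : ℤ) ∣ 2 → m = 1 := fun hm h =>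
    (Nat.coprime_two_right.2 hm).eq_one_of_dvd (by exact_mod_cast h)
  obtain ⟨hp', hq'⟩ := Nat.odd_mul.1 hodd
  have h1 := ZMod.intCast_eq_intCast_iff_dvd_sub (X * q + Y * p) 1 (p * q)
  have h2 := ZMod.intCast_eq_intCast_iff_dvd_sub (X * q + Y * p) (-1) (p * q)
  push_cast at h1 h2 ⊢
  rw [Ne, Ne, h1, h2]
  refine ⟨fun ⟨m, hm⟩ => hq (hdvd hq' ⟨p * m + 2 * X, ?_⟩),
    fun ⟨m, hm⟩ => hp (hdvd hp' ⟨-(q * m) - 2 * Y, ?_⟩)⟩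
  · linear_combination hm - hXY
  · linear_combination -hm - hXY

lemma eq_of_cast_reflections_eq (hodd : Odd (p * q)) (hp : p ≠ 1) (hq : q ≠ 1)
    (hXY : X * q - Y * p = 1)
    (h : (reflections hXY i j 0 0 : ZMod (p * q)) = reflections hXY i' j' 0 0 ∨
      (reflections hXY i j 0 0 : ZMod (p * q)) = -reflections hXY i' j' 0 0) : i = i' := by
  obtain ⟨h1, h2⟩ := cast_ne_one_and_ne_neg_one hodd hp hq hXY
  rw [reflections_apply_zero_zero, reflections_apply_zero_zero] at h
  by_contra hne
  obtain ⟨rfl, rfl⟩ | ⟨rfl, rfl⟩ : i = 0 ∧ i' = 1 ∨ i = 1 ∧ i' = 0 := by lia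
  · simp only [Matrix.cons_val_zero, Matrix.cons_val_one, Int.cast_one] at h
    exact h.elim (fun h => h1 h.symm) (fun h => h2 (by rw [h, neg_neg]))
  · simp only [Matrix.cons_val_zero, Matrix.cons_val_one, Int.cast_one] at h
    exact h.elim h1 h2

lemma exists_cast_eq_of_mul_self (hp : p.Prime) (hq : q.Prime) (hXY : X * q - Y * p = 1) {a : ℤ}
    (ha : (a : ZMod (p * q)) * a = 1) :
    ∃ i : Fin 2, (a : ZMod (p * q)) = (![1, X * q + Y * p] i : ℤ) ∨
      (a : ZMod (p * q)) = -(![1, X * q + Y * p] i : ℤ) := by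
  have hcop : IsCoprime (p : ℤ) q := ⟨-Y, X, by linear_combination hXY⟩
  have hmul : (p * q : ℤ) ∣ (a - 1) * (a + 1) := by
    have := (ZMod.intCast_zmod_eq_zero_iff_dvd (a * a - 1) (p * q)).1 (by simp [ha])
    push_cast at this
    exact this.trans (dvd_of_eq (by ring))
  have hsplit : ∀ {r : ℕ}, r.Prime → (r : ℤ) ∣ p * q → (r : ℤ) ∣ a - 1 ∨ (r : ℤ) ∣ a + 1 :=
    fun hr hdvd => (Nat.prime_iff_prime_int.1 hr).dvd_or_dvd (hdvd.trans hmul)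
  have hcast : ∀ b : ℤ, (p : ℤ) ∣ a - b → (q : ℤ) ∣ a - b → (a : ZMod (p * q)) = (b : ℤ) := by
    intro b hpb hqb
    rw [eq_comm, ZMod.intCast_eq_intCast_iff_dvd_sub]
    exact_mod_cast hcop.mul_dvd hpb hqb
  rcases hsplit hp (dvd_mul_right _ _) with ⟨m, hm⟩ | ⟨m, hm⟩ <;>
    rcases hsplit hq (dvd_mul_left _ _) with ⟨n, hn⟩ | ⟨n, hn⟩
  · exact ⟨0, .inl (hcast 1 ⟨m, hm⟩ ⟨n, hn⟩)⟩
  · exact ⟨1, .inl (hcast (X * q + Y * p) ⟨m - 2 * Y, by linear_combination hm - hXY⟩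
      ⟨n - 2 * X, by linear_combination hn + hXY⟩)⟩
  · exact ⟨1, .inr ((hcast (-(X * q + Y * p)) ⟨m + 2 * Y, by linear_combination hm + hXY⟩
      ⟨n + 2 * X, by linear_combination hn - hXY⟩).trans (Int.cast_neg _))⟩
  · exact ⟨0, .inr ((hcast (-1) ⟨m, by linear_combination hm⟩
      ⟨n, by linear_combination hn⟩).trans (Int.cast_neg _))⟩

lemma isCoprime_col_frame (hodd : Odd (p * q)) (hXY : X * q - Y * p = 1) (i j k : Fin 2) :
    IsCoprime ((frame p q X Y i j).col k 0) ((frame p q X Y i j).col k 1) := by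
  have hX : IsCoprime X p := ⟨q, -Y, by linear_combination hXY⟩
  have hY : IsCoprime Y q := ⟨-p, X, by linear_combination hXY⟩
  obtain ⟨hp, hq⟩ := Nat.odd_mul.1 hodd
  have hp2 : IsCoprime 2 (p : ℤ) := Nat.isCoprime_iff_coprime.2 (Nat.coprime_two_left.2 hp)
  have hq2 : IsCoprime 2 (q : ℤ) := Nat.isCoprime_iff_coprime.2 (Nat.coprime_two_left.2 hq)
  fin_cases i <;> fin_cases j <;> fin_cases k <;>
    simp [frame, isCoprime_one_left, isCoprime_one_right, hX, hY, hp2.mul_left hX, hq2.mul_left hY]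

lemma gcd_col_frame (hodd : Odd (p * q)) (i j k : Fin 2) :
    Int.gcd (p * q : ℕ) ((frame p q X Y i j).col k 1) = ![![p * q, 1], ![p, q]] i k := by
  have h2 : Int.gcd (p * q) 2 = 1 := mod_cast Nat.coprime_two_right.2 hodd
  fin_cases i <;> fin_cases j <;> fin_cases k <;> simp [frame, Int.natAbs_mul, h2]

lemma proj_endpoint_eq_iff (hN : Squarefree (p * q)) (hodd : Odd (p * q)) (hp : p ≠ 1)
    (hq : q ≠ 1) (hXY : X * q - Y * p = 1) :
    proj (p * q) (cusp (endpoint p q X Y i j k)) =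
      proj (p * q) (cusp (endpoint p q X Y i' j' k')) ↔ i = i' ∧ k = k' := by
  rw [endpoint, endpoint, proj_cuspOf_eq_iff hN (isCoprime_col_frame hodd hXY i j k)
    (isCoprime_col_frame hodd hXY i' j' k'), gcd_col_frame hodd, gcd_col_frame hodd]
  have hpq : p ≠ q := by
    rintro rfl
    exact hp (Nat.isUnit_iff.1 (hN p dvd_rfl))
  have hp0 : p ≠ 0 := by rintro rfl; simp at hodd
  have hq0 : q ≠ 0 := by rintro rfl; simp at hodd
  fin_cases i <;> fin_cases k <;> fin_cases i' <;> fin_cases k' <;> simp [*, eq_comm]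

lemma proj_endpoint_zero_ne_one (hN : Squarefree (p * q)) (hodd : Odd (p * q)) (hp : p ≠ 1)
    (hq : q ≠ 1) (hXY : X * q - Y * p = 1) (i j : Fin 2) :
    proj (p * q) (cusp (endpoint p q X Y i j 0)) ≠ proj (p * q) (cusp (endpoint p q X Y i j 1)) :=
  fun h => zero_ne_one ((proj_endpoint_eq_iff hN hodd hp hq hXY).1 h).2

lemma exists_proj_endpoint_eq (hp : p.Prime) (hq : q.Prime) (hN : Squarefree (p * q))
    (hodd : Odd (p * q)) (hXY : X * q - Y * p = 1) (c : OnePoint ℚ) :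
    ∃ i k, proj (p * q) (cusp (endpoint p q X Y i 0 k)) = proj (p * q) (cusp c) := by
  obtain ⟨v, hv, rfl⟩ := exists_cuspOf c
  obtain ⟨d, e, hd, he, hde⟩ :=
    (Nat.dvd_mul.1 (Int.gcd_dvd_natAbs_left (p * q : ℕ) (v 1)) :)
  have hlevel : ∃ i k, ![![p * q, 1], ![p, q]] i k = Int.gcd (p * q : ℕ) (v 1) := by
    rw [← hde]
    rcases (Nat.dvd_prime hp).1 hd with rfl | rfl <;> rcases (Nat.dvd_prime hq).1 he with rfl | rfl
    exacts [⟨0, 1, rfl⟩, ⟨1, 1, (one_mul _).symm⟩, ⟨1, 0, (mul_one _).symm⟩, ⟨0, 0, rfl⟩]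
  obtain ⟨i, k, hik⟩ := hlevel
  refine ⟨i, k, (proj_cuspOf_eq_iff hN (isCoprime_col_frame hodd hXY i 0 k) hv).2 ?_⟩
  rw [gcd_col_frame hodd, hik]

/-- The image in `X₀(pq)` of the two closed geodesics with index `i`: the curve `𝒞₁` for `i = 0`
and `𝒞₃` for `i = 1`. -/
def curve (p q : ℕ) (X Y : ℤ) (i : Fin 2) : Set (X0 (p * q)) :=
  proj (p * q) '' (closedGeodesic (endpoint p q X Y i 0 0) (endpoint p q X Y i 0 1) ∪
    closedGeodesic (endpoint p q X Y i 1 0) (endpoint p q X Y i 1 1))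

lemma mem_curve_iff (hN : Squarefree (p * q)) (hodd : Odd (p * q)) (hp : p ≠ 1) (hq : q ≠ 1)
    (hXY : X * q - Y * p = 1) {x : X0 (p * q)} : x ∈ curve p q X Y i ↔
      (∃ j, ∃ z ∈ mirror (reflections hXY i j), proj (p * q) (point z) = x) ∨
        ∃ k, proj (p * q) (cusp (endpoint p q X Y i 0 k)) = x := by
  have hends := fun k => (proj_endpoint_eq_iff (i := i) (j := 1) (k := k) (j' := 0) hN hodd hp hq
    hXY).2 ⟨rfl, rfl⟩
  simp only [curve, closedGeodesic, geodesic_endpoint hXY, Set.image_union, Set.mem_union,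
    Set.image_image, Set.image_pair, hends, Set.mem_image, Set.mem_insert_iff,
    Set.mem_singleton_iff, Fin.exists_fin_two, eq_comm (a := x)]
  rw [or_or_or_comm, or_self]

lemma four_lt_mul (hodd : Odd (p * q)) (hp : p ≠ 1) (hq : q ≠ 1) : 4 < p * q := by
  obtain ⟨⟨m, rfl⟩, ⟨n, rfl⟩⟩ := Nat.odd_mul.1 hodd
  have hm : 1 ≤ m := by lia
  have hn : 1 ≤ n := by lia
  nlinarith

lemma eq_of_mem_mirror_reflections (hodd : Odd (p * q)) (hp : p ≠ 1) (hq : q ≠ 1)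
    (hXY : X * q - Y * p = 1) {z w : ℍ} (hz : z ∈ mirror (reflections hXY i j))
    (hw : w ∈ mirror (reflections hXY i' j'))
    (hzw : proj (p * q) (point z) = proj (p * q) (point w)) : i = i' ∧ j = j' ∧ z = w := by
  have h4 := four_lt_mul hodd hp hq
  obtain ⟨hcast, htwo⟩ := cast_eq_and_mem_Gamma_two_iff_of_proj_eq h4
    (reflections_mem_Gamma0 hXY i j) (reflections_mem_Gamma0 hXY i' j') hz hw hzw
  obtain rfl := eq_of_cast_reflections_eq hodd hp hq hXY hcast
  rw [reflections_mem_Gamma_two_iff hodd, reflections_mem_Gamma_two_iff hodd] at htwo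
  obtain rfl : j = j' := by lia
  exact ⟨rfl, rfl, injOn_proj_mirror h4 hodd (reflections_mem_Gamma0 hXY i j) hz hw hzw⟩

lemma exists_mem_mirror_reflections (hp : p.Prime) (hq : q.Prime) (hodd : Odd (p * q))
    (hXY : X * q - Y * p = 1) {z : ℍ} (hz : proj (p * q) (point z) ∈ fixSet (p * q)) :
    ∃ i j, ∃ w ∈ mirror (reflections hXY i j),
      proj (p * q) (point w) = proj (p * q) (point z) := by
  obtain ⟨h, hh, hzh⟩ := proj_point_mem_fixSet_iff.1 hz
  obtain ⟨i, hi⟩ := exists_cast_eq_of_mul_self hp hq hXY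
    (cast_mul_self_eq_one (diag_eq_of_mem_mirror hzh) hh)
  obtain ⟨j, hj⟩ : ∃ j : Fin 2, h ∈ Gamma 2 ↔ j = 0 := by
    by_cases h2 : h ∈ Gamma 2
    exacts [⟨0, iff_of_true h2 rfl⟩, ⟨1, iff_of_false h2 one_ne_zero⟩]
  refine ⟨i, j, exists_mem_mirror_proj_eq hodd hh (reflections_mem_Gamma0 hXY i j)
    (reflections_diag hXY i j) ?_ ?_ hzh⟩
  · rwa [reflections_apply_zero_zero]
  · rw [hj, reflections_mem_Gamma_two_iff hodd]

theorem fixSet_eq_union (hp : p.Prime) (hq : q.Prime) (hN : Squarefree (p * q))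
    (hodd : Odd (p * q)) (hXY : X * q - Y * p = 1) :
    fixSet (p * q) = curve p q X Y 0 ∪ curve p q X Y 1 := by
  have hmem := fun i (x : X0 (p * q)) =>
    mem_curve_iff (i := i) (x := x) hN hodd hp.ne_one hq.ne_one hXY
  ext x
  rw [Set.mem_union, ← Fin.exists_fin_two (p := fun i => x ∈ curve p q X Y i)]
  simp only [hmem]
  constructor
  · intro hx
    obtain ⟨y, rfl⟩ := Quotient.exists_rep x
    cases y with
    | point z =>
      obtain ⟨i, j, w, hw, hwz⟩ := exists_mem_mirror_reflections hp hq hodd hXY hx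
      exact ⟨i, .inl ⟨j, w, hw, hwz⟩⟩
    | cusp c =>
      obtain ⟨i, k, hik⟩ := exists_proj_endpoint_eq hp hq hN hodd hXY c
      exact ⟨i, .inr ⟨k, hik⟩⟩
  · rintro ⟨i, ⟨j, z, hz, rfl⟩ | ⟨k, rfl⟩⟩
    · exact proj_point_mem_fixSet_iff.2 ⟨_, reflections_mem_Gamma0 hXY i j, hz⟩
    · exact cusps_subset_fixSet hN ⟨_, rfl⟩

theorem disjoint_curve (hN : Squarefree (p * q)) (hodd : Odd (p * q)) (hp : p ≠ 1) (hq : q ≠ 1)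
    (hXY : X * q - Y * p = 1) (hi : i ≠ i') : Disjoint (curve p q X Y i) (curve p q X Y i') := by
  refine Set.disjoint_left.2 fun x hx hx' => hi ?_
  rw [mem_curve_iff hN hodd hp hq hXY] at hx hx'
  obtain ⟨j, z, hz, rfl⟩ | ⟨k, rfl⟩ := hx <;> obtain ⟨j', w, hw, hwz⟩ | ⟨k', hk⟩ := hx'
  · exact (eq_of_mem_mirror_reflections hodd hp hq hXY hz hw hwz.symm).1
  · exact absurd hk (proj_cusp_ne_point _ _)
  · exact absurd hwz.symm (proj_cusp_ne_point _ _)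
  · exact ((proj_endpoint_eq_iff hN hodd hp hq hXY).1 hk.symm).1

theorem curve_inter_cusps (hN : Squarefree (p * q)) (hodd : Odd (p * q)) (hp : p ≠ 1)
    (hq : q ≠ 1) (hXY : X * q - Y * p = 1) (i : Fin 2) :
    curve p q X Y i ∩ cusps (p * q) = {proj (p * q) (cusp (endpoint p q X Y i 0 0)),
      proj (p * q) (cusp (endpoint p q X Y i 0 1))} := by
  ext x
  simp only [Set.mem_inter_iff, mem_curve_iff hN hodd hp hq hXY, Fin.exists_fin_two (p := fun k =>
    proj (p * q) (cusp (endpoint p q X Y i 0 k)) = x), Set.mem_insert_iff, Set.mem_singleton_iff,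
    eq_comm (a := x)]
  constructor
  · rintro ⟨⟨j, z, -, rfl⟩ | hx, c, hc⟩
    · exact absurd hc (proj_cusp_ne_point _ _)
    · exact hx
  · rintro (rfl | rfl)
    exacts [⟨.inr (.inl rfl), _, rfl⟩, ⟨.inr (.inr rfl), _, rfl⟩]

theorem disjoint_geodesic_endpoint (hodd : Odd (p * q)) (hp : p ≠ 1) (hq : q ≠ 1)
    (hXY : X * q - Y * p = 1) (hij : (i, j) ≠ (i', j')) :
    Disjoint (geodesic (endpoint p q X Y i j 0) (endpoint p q X Y i j 1))
      (geodesic (endpoint p q X Y i' j' 0) (endpoint p q X Y i' j' 1)) := by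
  rw [geodesic_endpoint hXY, geodesic_endpoint hXY, Set.disjoint_left]
  intro z hz hz'
  obtain ⟨rfl, rfl, -⟩ := eq_of_mem_mirror_reflections hodd hp hq hXY hz hz' rfl
  exact hij rfl

theorem injOn_proj_geodesic_endpoint (hodd : Odd (p * q)) (hp : p ≠ 1) (hq : q ≠ 1)
    (hXY : X * q - Y * p = 1) : Set.InjOn (fun z => proj (p * q) (point z))
      (⋃ i, ⋃ j, geodesic (endpoint p q X Y i j 0) (endpoint p q X Y i j 1)) := by
  simp only [geodesic_endpoint hXY]
  intro z hz w hw hzw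
  obtain ⟨i, j, hz⟩ := Set.mem_iUnion₂.1 hz
  obtain ⟨i', j', hw⟩ := Set.mem_iUnion₂.1 hw
  exact (eq_of_mem_mirror_reflections hodd hp hq hXY hz hw hzw).2.2

theorem isSimpleClosedCurve_curve (hN : Squarefree (p * q)) (hodd : Odd (p * q)) (hp : p ≠ 1)
    (hq : q ≠ 1) (hXY : X * q - Y * p = 1) (i : Fin 2) :
    IsSimpleClosedCurve (curve p q X Y i) := by
  refine isSimpleClosedCurve_of_geodesics (det_frame_pos hXY i 0) (det_frame_pos hXY i 1)
    (fun k => (proj_endpoint_eq_iff hN hodd hp hq hXY).2 ⟨rfl, rfl⟩)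
    (proj_endpoint_zero_ne_one hN hodd hp hq hXY i 0)
    ((injOn_proj_geodesic_endpoint hodd hp hq hXY).mono (Set.union_subset ?_ ?_))
    (disjoint_geodesic_endpoint hodd hp hq hXY (by simp))
  · exact Set.subset_iUnion₂_of_subset i 0 subset_rfl
  · exact Set.subset_iUnion₂_of_subset i 1 subset_rfl

theorem exists_moveCusp_endpoint_eq (hN : Squarefree (p * q)) (hodd : Odd (p * q)) (hp : p ≠ 1)
    (hq : q ≠ 1) (hXY : X * q - Y * p = 1) (i k : Fin 2) :
    ∃ g ∈ Gamma0 (p * q), moveCusp g (endpoint p q X Y i 0 k) = endpoint p q X Y i 1 k :=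
  proj_cusp_eq_iff.1 ((proj_endpoint_eq_iff hN hodd hp hq hXY).2 ⟨rfl, rfl⟩)

end Configuration

end ModCurve

theorem lemma6p3 (p q : ℕ) (hp : p.Prime) (hq : q.Prime) (hp2 : p ≠ 2) (hq2 : q ≠ 2)
    (hpq : p ≠ q) :
    ∃ C : Fin 2 → Set (ModCurve.X0 (p * q)),
      -- (i) the fixed set is the disjoint union of two simple closed curves
      ModCurve.fixSet (p * q) = C 0 ∪ C 1 ∧
      Disjoint (C 0) (C 1) ∧
      (∀ i, ModCurve.IsSimpleClosedCurve (C i)) ∧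
      -- each curve contains exactly two cusps, and there are no others
      ModCurve.proj (p * q) (.cusp OnePoint.infty) ≠
        ModCurve.proj (p * q) (.cusp ((0 : ℚ) : OnePoint ℚ)) ∧
      ModCurve.proj (p * q) (.cusp ((1 / (p : ℚ) : ℚ) : OnePoint ℚ)) ≠
        ModCurve.proj (p * q) (.cusp ((1 / (q : ℚ) : ℚ) : OnePoint ℚ)) ∧
      C 0 ∩ ModCurve.cusps (p * q) =
        {ModCurve.proj (p * q) (.cusp OnePoint.infty),
          ModCurve.proj (p * q) (.cusp ((0 : ℚ) : OnePoint ℚ))} ∧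
      C 1 ∩ ModCurve.cusps (p * q) =
        {ModCurve.proj (p * q) (.cusp ((1 / (p : ℚ) : ℚ) : OnePoint ℚ)),
          ModCurve.proj (p * q) (.cusp ((1 / (q : ℚ) : ℚ) : OnePoint ℚ))} ∧
      ModCurve.cusps (p * q) ⊆ ModCurve.fixSet (p * q) ∧
      -- (ii) the pair of geodesics for the curve `C i` has endpoints `a i j`, `b i j`, `j = 0, 1`
      ∃ a b : Fin 2 → Fin 2 → OnePoint ℚ,
        (∀ i j, a i j ≠ b i j) ∧
        (∀ i j i' j', (i, j) ≠ (i', j') →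
          Disjoint (ModCurve.geodesic (a i j) (b i j))
            (ModCurve.geodesic (a i' j') (b i' j'))) ∧
        (∀ i, C i = ModCurve.proj (p * q) ''
          (ModCurve.closedGeodesic (a i 0) (b i 0) ∪
            ModCurve.closedGeodesic (a i 1) (b i 1))) ∧
        Set.InjOn (fun z => ModCurve.proj (p * q) (.point z))
          (⋃ i, ⋃ j, ModCurve.geodesic (a i j) (b i j)) ∧
        (∀ i, (∃ g ∈ CongruenceSubgroup.Gamma0 (p * q),
            ModCurve.moveCusp g (a i 0) = a i 1) ∧
          (∃ g ∈ CongruenceSubgroup.Gamma0 (p * q),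
            ModCurve.moveCusp g (b i 0) = b i 1)) := by
  have hcop : p.Coprime q := (Nat.coprime_primes hp hq).2 hpq
  have hN : Squarefree (p * q) := (Nat.squarefree_mul hcop).2 ⟨hp.squarefree, hq.squarefree⟩
  have hodd : Odd (p * q) := (hp.odd_of_ne_two hp2).mul (hq.odd_of_ne_two hq2)
  have hp1 : p ≠ 1 := hp.ne_one
  have hq1 : q ≠ 1 := hq.ne_one
  obtain ⟨X, Y, hXY⟩ : ∃ X Y : ℤ, X * q - Y * p = 1 := by
    obtain ⟨X, Z, hXZ⟩ : IsCoprime (q : ℤ) p := Nat.isCoprime_iff_coprime.2 hcop.symm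
    exact ⟨X, -Z, by linear_combination hXZ⟩
  have hzero : ((0 : ℚ) : OnePoint ℚ) = ModCurve.endpoint p q X Y 0 0 1 := by
    simp [ModCurve.endpoint, ModCurve.frame, ModCurve.cuspOf]
  have hcol := ModCurve.isCoprime_col_frame hodd hXY 1 0
  rw [hzero, ModCurve.proj_one_div_eq hN (hcol 0) hp.ne_zero rfl,
    ModCurve.proj_one_div_eq hN (hcol 1) hq.ne_zero rfl]
  exact ⟨ModCurve.curve p q X Y, ModCurve.fixSet_eq_union hp hq hN hodd hXY,
    ModCurve.disjoint_curve hN hodd hp1 hq1 hXY zero_ne_one,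
    ModCurve.isSimpleClosedCurve_curve hN hodd hp1 hq1 hXY,
    ModCurve.proj_endpoint_zero_ne_one hN hodd hp1 hq1 hXY 0 0,
    ModCurve.proj_endpoint_zero_ne_one hN hodd hp1 hq1 hXY 1 0,
    ModCurve.curve_inter_cusps hN hodd hp1 hq1 hXY 0,
    ModCurve.curve_inter_cusps hN hodd hp1 hq1 hXY 1, ModCurve.cusps_subset_fixSet hN,
    fun i j => ModCurve.endpoint p q X Y i j 0, fun i j => ModCurve.endpoint p q X Y i j 1,
    ModCurve.endpoint_zero_ne_one hXY,
    fun _ _ _ _ => ModCurve.disjoint_geodesic_endpoint hodd hp1 hq1 hXY, fun _ => rfl,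
    ModCurve.injOn_proj_geodesic_endpoint hodd hp1 hq1 hXY, fun i =>
    ⟨ModCurve.exists_moveCusp_endpoint_eq hN hodd hp1 hq1 hXY i 0,
      ModCurve.exists_moveCusp_endpoint_eq hN hodd hp1 hq1 hXY i 1⟩⟩
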